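/- **Setting.** Let $M$ be a compact connected smooth Riemannian manifold (without boundary) whose first integral homology is free, $H_1(M;\mathbb Z)\cong\mathbb Z^b$, with basis $\Gamma_1,\dots,\Gamma_b$. Let $\pi:\tilde M_a\to M$ be the universal Abelian cover, i.e. the connected covering with $\pi_*\pi_1(\tilde M_a)=[\pi_1(M),\pi_1(M)]$. For $\vec n\in\mathbb Z^b$ let $\delta_{\vec n}$ be the deck transformation such that paths from $\tilde x$ to $\delta_{\vec n}\tilde x$ project to loops of homology class $\sum_i n_i\Gamma_i$. Let $\omega_1,\dots,\omega_b$ be smooth closed one-forms on $M$ (for instance harmonic ones) with $\int_{\Gamma_j}\omega_i=\delta_{ij}$, fix $\tilde x_0\in\tilde M_a$, and let $\tilde\iota:\tilde M_a\to\mathbb R^b$ be the Abel–Jacobi–Albanese map $\tilde\iota_i(\tilde x)=\int_{\tilde x_0}^{\tilde x}\pi^*\omega_i$, the integral being along any smooth path. Let $f:M\to M$ be continuous, let $\tilde f:\tilde M_a\to\tilde M_a$ be a lift of $f$, let $A$ be the integer matrix of $f_*$ on $H_1(M;\mathbb Z)$ in the basis $\Gamma_i$, and let $\Phi_A$ be the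 endomorphism of $\mathbb T^b=\mathbb R^b/\mathbb Z^b$ induced by $A$. Fix a norm $\|\cdot\|$ on $\mathbb R^b$. We say that $o(\tilde x,\tilde f)$ globally shadows $o(\tilde y,A)$ if there is $K$ with $\|\tilde\iota\tilde f^n(\tilde x)-A^n\tilde y\|\le K$ for all $n\ge 0$. **Theorem [Franks, Shub, Band].** Suppose $f$ is $H_1$-expanding, i.e. all eigenvalues of $A$ lie outside the unit circle. Then: 1. $\tilde\iota\tilde f-A\tilde\iota$ descends to a continuous function $\sigma:M\to\mathbb R^b$, and for every $\tilde x\in\tilde M_a$, with $x=\pi(\tilde x)$, the limit $\tilde\beta(\tilde x)=\lim_{n\to\infty}A^{-n}\tilde\iota\tilde f^n(\tilde x)$ exists and equals $\tilde\iota(\tilde x)+\sum_{n\ge1}A^{-n}\sigma(f^{n-1}x)$. The map $\tilde\beta:\tilde M_a\to\mathbb R^b$ is continuous. 2. Let $\lambda>1$ be such that the spectral radius of $A^{-1}$ is less than $1/\lambda$. If $f$ is $L$-Lipschitz for the Riemannian distance of $M$, then $\tilde\beta$ is $\nu$-Hölder on bounded scales for every $0<\nu<\min(\log\lambda/\log L,\,1)$: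 for every $R$ there is $C$ with $\|\tilde\beta(\tilde x)-\tilde\beta(\tilde y)\|\le C\,d(\tilde x,\tilde y)^\nu$ whenever $d(\tilde x,\tilde y)\le R$, where $d$ is the distance on $\tilde M_a$ of the lifted Riemannian metric. 3. $\tilde\beta(\delta_{\vec n}\tilde x)=\tilde\beta(\tilde x)+\vec n$ for all $\vec n\in\mathbb Z^b$, and $\tilde\beta\circ\tilde f=A\circ\tilde\beta$. Hence $\tilde\beta$ descends to a continuous map $\beta:M\to\mathbb T^b$ with $\beta\circ f=\Phi_A\circ\beta$, a semiconjugacy of $f$ to $\Phi_A$ acting on the compact set $\beta(M)$, which satisfies $\Phi_A(\beta(M))\subset\beta(M)$, with equality if $f$ is onto. 4. $o(\tilde x,\tilde f)$ globally shadows $o(\tilde y,A)$ if and only if $\tilde y=\tilde\beta(\tilde x)$. Hence $\tilde\beta=\tilde\alpha$, where $\tilde\alpha(\tilde x)$ is the unique $\tilde y$ such that $o(\tilde x,\tilde f)$ globally shadows $o(\tilde y,A)$. -/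

import Mathlib

open CategoryTheory AlgebraicTopology Set Filter Topology Bundle Manifold
open scoped Simplicial ENNReal NNReal ContDiff Matrix

universe u v

noncomputable section

/-! ### First singular homology with integer coefficients -/

/-- The group of coefficients `ℤ`, lifted to the universe of the space. -/
abbrev intCoeff : ModuleCat.{u} ℤ := ModuleCat.of ℤ (ULift.{u} ℤ)

/-- The first singular homology `H₁(X; ℤ)`. -/
abbrev H1 (X : Type u) [TopologicalSpace X] : ModuleCat.{u} ℤ :=
  ((singularHomologyFunctor (ModuleCat.{u} ℤ) 1).obj intCoeff.{u}).obj (TopCat.of X)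

/-- The map `f_* : H₁(X; ℤ) → H₁(X; ℤ)` induced by `f`. -/
def H1map {X : Type u} [TopologicalSpace X] (f : C(X, X)) : H1 X →ₗ[ℤ] H1 X :=
  (((singularHomologyFunctor (ModuleCat.{u} ℤ) 1).obj intCoeff.{u}).map (TopCat.ofHom f)).hom

/-- A path as a singular 1-simplex, from the vertex `0` to the vertex `1`. -/
def pathSimplex {X : Type u} [TopologicalSpace X] {x y : X} (γ : Path x y) :
    (TopCat.toSSet.obj (TopCat.of X)) _⦋1⦌ :=
  ((TopCat.of X).toSSetObjEquiv (.op ⦋1⦌)).symm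
    (γ.toContinuousMap.comp (toContinuousMap stdSimplexHomeomorphUnitInterval))

/-- The two faces of the singular 1-simplex of a loop agree. -/
theorem pathSimplex_faces {X : Type u} [TopologicalSpace X] {x : X} (γ : Path x x) :
    (TopCat.toSSet.obj (TopCat.of X)).δ (0 : Fin 2) (pathSimplex γ) =
      (TopCat.toSSet.obj (TopCat.of X)).δ (1 : Fin 2) (pathSimplex γ) := by
  have key : ∀ (i : Fin 2) (s : stdSimplex ℝ (Fin 1)),
      (TopCat.of X).toSSetObjEquiv (.op ⦋0⦌)
        ((TopCat.toSSet.obj (TopCat.of X)).δ i (pathSimplex γ)) s = x := by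
    intro i s
    have h1 : (TopCat.of X).toSSetObjEquiv (.op ⦋0⦌)
        ((TopCat.toSSet.obj (TopCat.of X)).δ i (pathSimplex γ)) s =
        γ (stdSimplexHomeomorphUnitInterval (stdSimplex.map (Fin.succAbove i) s)) := rfl
    rw [h1, Subsingleton.elim s (stdSimplex.vertex 0), stdSimplex.map_vertex]
    fin_cases i
    · exact γ.target
    · exact γ.source
  apply ((TopCat.of X).toSSetObjEquiv (.op ⦋0⦌)).injective
  ext s
  exact (key 0 s).trans (key 1 s).symm

/-- The class in `H₁(X; ℤ)` of a loop: the class of the singular cycle given by the loop,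
with coefficient `1`. -/
def loopClass {X : Type u} [TopologicalSpace X] {x : X} (γ : Path x x) : H1 X :=
  let K := (TopCat.toSSet.obj (TopCat.of X)).chainComplex intCoeff.{u}
  (K.liftCycles ((TopCat.toSSet.obj (TopCat.of X)).ιChainComplex (pathSimplex γ)) 0
    (ChainComplex.next_nat_succ 0)
    (by simp [K, SSet.ιChainComplex_d, Fin.sum_univ_two, pathSimplex_faces]) ≫ K.homologyπ 1).hom (ULift.up 1)

/-! ### The universal Abelian cover -/

/-- `p : E → M` is a universal Abelian cover of `M`: a covering with path connected total space
such that the image of `π₁(E)` in `π₁(M)` is the commutator subgroup of `π₁(M)`; equivalently,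
`E` is the quotient of the universal cover by the commutator subgroup of the fundamental group. -/
structure IsUniversalAbelianCover {M : Type u} {E : Type v} [TopologicalSpace M]
    [TopologicalSpace E] (p : C(E, M)) : Prop where
  isCoveringMap : IsCoveringMap p
  pathConnectedSpace : PathConnectedSpace E
  range_map_eq : ∀ x : E,
    (FundamentalGroup.map p x).range = commutator (FundamentalGroup M (p x))

/-- `δ` is the deck transformation `δ_n` corresponding to `n ∈ ℤ^b`, with respect to a basis `Γ` of
`H₁(M; ℤ)`: it covers the identity, and every path from a point `x` to `δ x` projects to a loop
of homology class `∑ nᵢ Γᵢ`. -/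
def IsDeckTransformation {M : Type u} {E : Type v} [TopologicalSpace M] [TopologicalSpace E]
    {b : ℕ} (p : C(E, M)) (Γ : Module.Basis (Fin b) ℤ (H1 M)) (n : Fin b → ℤ) (δ : E ≃ₜ E) :
    Prop :=
  ∃ hδ : ∀ x, p (δ x) = p x, ∀ (x : E) (γ : Path x (δ x)),
    loopClass ((γ.map p.continuous).cast rfl (hδ x).symm) = ∑ i, n i • Γ i

/-! ### Closed one-forms and their integrals -/

section Forms

variable {d : ℕ} {M : Type u} [TopologicalSpace M] [ChartedSpace (EuclideanSpace ℝ (Fin d)) M]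

variable (d M) in
/-- (Not necessarily continuous) one-forms on a manifold `M` of dimension `d`. -/
abbrev OneForm : Type u := ∀ x : M, TangentSpace (𝓡 d) x →L[ℝ] ℝ

/-- The one-form `θ` read in the chart at `c`, i.e. its pullback under the inverse of the chart. -/
def OneForm.inChart (θ : OneForm d M) (c : M) (y : EuclideanSpace ℝ (Fin d)) :
    EuclideanSpace ℝ (Fin d) →L[ℝ] ℝ :=
  (θ ((chartAt (EuclideanSpace ℝ (Fin d)) c).symm y)).comp
    (mfderiv (𝓡 d) (𝓡 d) (chartAt (EuclideanSpace ℝ (Fin d)) c).symm y)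

/-- `θ` is a smooth closed one-form: in each chart it is smooth and `dθ = 0`. -/
structure OneForm.IsSmoothClosed (θ : OneForm d M) : Prop where
  smooth : ∀ c : M, ContDiffOn ℝ ∞ (θ.inChart c) (chartAt (EuclideanSpace ℝ (Fin d)) c).target
  closed : ∀ c : M, ∀ y ∈ (chartAt (EuclideanSpace ℝ (Fin d)) c).target,
    ∀ v w : EuclideanSpace ℝ (Fin d),
      fderiv ℝ (θ.inChart c) y v w - fderiv ℝ (θ.inChart c) y w v = 0

variable (d) in
/-- The curve `c`, restricted to `[0, 1]`, is smooth. -/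
def IsSmoothCurve (c : ℝ → M) : Prop := ContMDiffOn 𝓘(ℝ, ℝ) (𝓡 d) ∞ c (Icc 0 1)

/-- The integral of `θ` along the curve `c`, restricted to `[0, 1]`. -/
def OneForm.lineIntegral (θ : OneForm d M) (c : ℝ → M) : ℝ :=
  ∫ t in (0 : ℝ)..1, θ (c t) (mfderiv 𝓘(ℝ, ℝ) (𝓡 d) c t (1 : ℝ))

/-- The closed one-form `θ` takes the value `r` on the homology class `h`: it has integral `r`
along some (equivalently, any) smooth loop in the class `h`. -/
def OneForm.HasPeriod (θ : OneForm d M) (h : H1 M) (r : ℝ) : Prop :=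
  ∃ (x : M) (γ : Path x x), IsSmoothCurve d γ.extend ∧ loopClass γ = h ∧
    θ.lineIntegral γ.extend = r

variable {E : Type v} [TopologicalSpace E] {b : ℕ}

open Classical in
/-- The Abel-Jacobi-Albanese map `ι̃ : E → ℝ^b` with base point `x₀`: choose a path from `x₀` to
`x` in the cover which is smooth (that is, whose projection to `M` is smooth), and integrate
the lifts of the forms `θᵢ` along it (that is, the forms `θᵢ` along its projection). -/
def abelJacobi (p : C(E, M)) (θ : Fin b → OneForm d M) (x₀ x : E) : Fin b → ℝ :=
  if h : ∃ γ : Path x₀ x, IsSmoothCurve d (p ∘ γ.extend) then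
    fun i => (θ i).lineIntegral (p ∘ h.choose.extend)
  else 0

variable (d) in
/-- The distance on the cover `E` induced by the lift of the Riemannian metric of `M`: the infimum
of the lengths of (the projections of) the `C¹` paths in `E` from `x` to `y`. -/
def coverEDist [RiemannianBundle (fun x : M => TangentSpace (𝓡 d) x)] (p : C(E, M)) (x y : E) :
    ℝ≥0∞ :=
  ⨅ (γ : Path x y) (_ : ContMDiffOn 𝓘(ℝ, ℝ) (𝓡 d) 1 (p ∘ γ.extend) (Icc 0 1)),
    pathELength (𝓡 d) (p ∘ γ.extend) 0 1

end Forms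

/-! ### The action on first homology, toral endomorphisms, and shadowing -/

section Dynamics

variable {b : ℕ}

/-- The integer matrix of `f_* : H₁(M; ℤ) → H₁(M; ℤ)` in the basis `Γ`. -/
def homologyMatrix {M : Type u} [TopologicalSpace M] (Γ : Module.Basis (Fin b) ℤ (H1 M))
    (f : C(M, M)) : Matrix (Fin b) (Fin b) ℤ :=
  LinearMap.toMatrix Γ Γ (H1map f)

/-- The integer matrix `A`, with real entries. -/
abbrev realMatrix (A : Matrix (Fin b) (Fin b) ℤ) : Matrix (Fin b) (Fin b) ℝ :=
  A.map (Int.cast : ℤ → ℝ)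

/-- The integer matrix `A`, with complex entries. -/
abbrev complexMatrix (A : Matrix (Fin b) (Fin b) ℤ) : Matrix (Fin b) (Fin b) ℂ :=
  A.map (Int.cast : ℤ → ℂ)

/-- All (complex) eigenvalues of `A` are outside the unit circle. -/
def IsExpandingMatrix (A : Matrix (Fin b) (Fin b) ℤ) : Prop :=
  ∀ μ ∈ spectrum ℂ (complexMatrix A), 1 < ‖μ‖

/-- The projection `ℝ^b → 𝕋^b`. -/
def torusProj (v : Fin b → ℝ) : Fin b → UnitAddCircle := fun i => (v i : UnitAddCircle)

/-- The toral endomorphism `Φ_A : 𝕋^b → 𝕋^b`. -/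
def toralEndomorphism (A : Matrix (Fin b) (Fin b) ℤ) (y : Fin b → UnitAddCircle) :
    Fin b → UnitAddCircle := fun i => ∑ j, A i j • y j

variable {E : Type v}

/-- The orbits `o(x, F)` and `o(y, A)` globally shadow, with respect to the map `ι : E → ℝ^b` and
the norm `N` on `ℝ^b`. -/
def GloballyShadows (N : Seminorm ℝ (Fin b → ℝ)) (ι : E → Fin b → ℝ) (F : E → E)
    (A : Matrix (Fin b) (Fin b) ℝ) (x : E) (y : Fin b → ℝ) : Prop :=
  ∃ K : ℝ, ∀ n : ℕ, N (ι (F^[n] x) - (A ^ n) *ᵥ y) ≤ K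

open Classical in
/-- The map `α̃`: the unique `y` such that `o(x, F)` globally shadows `o(y, A)`. -/
def shadowingMap (N : Seminorm ℝ (Fin b → ℝ)) (ι : E → Fin b → ℝ) (F : E → E)
    (A : Matrix (Fin b) (Fin b) ℝ) (x : E) : Fin b → ℝ :=
  if h : ∃! y, GloballyShadows N ι F A x y then h.choose else 0

end Dynamics

end

/-! The displacement `σ = ι ∘ F - A ι` makes `A⁻¹ ^ n ι(Fⁿ x)` telescope to `ι x` plus a partial sum
of `∑ A⁻¹ ^ (k + 1) σ(fᵏ (p x))`. The eigenvalues of `A⁻¹` lie inside the unit circle, so its powers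
decay geometrically; `σ` is bounded because `M` is compact. Hence the series converges uniformly,
and its sum with `ι` is a continuous map `βt` at bounded distance from `ι`. The relation `βt ∘ F = A
βt` follows by shifting the limit, and shows that `A ^ n βt(x)` stays near `ι(Fⁿ x)`. Conversely,
applying `A⁻¹ ^ n` to a bounded error `ι(Fⁿ x) - A ^ n y` sends it to zero, which forces `y =
βt(x)`.

The topological content is that `σ` lives on `M`. A path between two points of a fibre projects to a
loop with some class `n`; `ι` changes by `n` along it, and `ι ∘ F` by `A n`, since the image loop
has class `f_* n`. This requires that the integral of a closed form depend only on the singular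
homology class, also for loops that are merely continuous, as `f` is. So each form is replaced by
its `LocalPrimitives`, which are continued along continuous maps from simply connected spaces by
lifting to the covering of germs. Evaluated on singular 1-simplices they give a cocycle, whence
`homologyIntegral`. On the cover, all loops project to commutators, so global primitives `g` exist,
and `abelJacobi` is `g - g x₀`.

For the Hölder estimate, `ι` is Lipschitz for the lifted distance and `σ` is Lipschitz on `M`, so
the differences of the terms of the series are dominated by a geometric series of ratio `L ^ ν / λ`.
-/

noncomputable section

/-! ### Local primitives and their continuation along maps -/

theorem Convex.locallyPathConnectedSpace_coe {W : Type*} [NormedAddCommGroup W] [NormedSpace ℝ W]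
    {s : Set W} (hs : Convex ℝ s) : LocallyPathConnectedSpace s := by
  refine LocallyPathConnectedSpace.of_bases (p := fun _ r => 0 < r)
    (s := fun (x : s) (r : ℝ) => Metric.ball x r) (fun x => Metric.nhds_basis_ball) ?_
  intro x r hr
  have hpc : IsPathConnected (s ∩ Metric.ball (x : W) r) :=
    (hs.inter (convex_ball _ _)).isPathConnected ⟨x, x.2, Metric.mem_ball_self hr⟩
  have himg : (Subtype.val '' Metric.ball x r : Set W) = s ∩ Metric.ball (x : W) r := by
    ext y
    constructor
    · rintro ⟨z, hz, rfl⟩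
      exact ⟨z.2, hz⟩
    · rintro ⟨hy, hyr⟩
      exact ⟨⟨y, hy⟩, hyr, rfl⟩
  rw [Topology.IsInducing.subtypeVal.isPathConnected_iff, himg]
  exact hpc

/-- Locally defined functions on `X`, up to locally constant functions: an open cover with a
function on each of its members such that the differences are locally constant. -/
structure LocalPrimitives (X : Type*) [TopologicalSpace X] (V : Type*) [AddCommGroup V] where
  /-- The member of the cover at a point. -/
  U : X → Set X
  /-- The function at a point. -/
  h : X → X → V
  isOpen_U : ∀ i, IsOpen (U i)
  mem_U : ∀ i, i ∈ U i
  compat : ∀ i j, ∀ x ∈ U i ∩ U j, ∀ᶠ y in 𝓝 x, h i y - h j y = h i x - h j x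

namespace LocalPrimitives

variable {X : Type*} [TopologicalSpace X] {V : Type*} [AddCommGroup V] (P : LocalPrimitives X V)
variable {Z Z' : Type*} [TopologicalSpace Z] [TopologicalSpace Z']

/-- `g` is a primitive along `c`, if locally it differs from the local primitives, composed with
`c`, by constants. -/
def IsPrimitiveAlong (c : Z → X) (g : Z → V) : Prop :=
  ∀ z i, c z ∈ P.U i → ∀ᶠ z' in 𝓝 z, g z' - g z = P.h i (c z') - P.h i (c z)

variable {P}

/-- One index at each point suffices: by `compat`, changing the index changes the local primitive by
a locally constant function. -/
theorem isPrimitiveAlong_of_exists {c : Z → X} {g : Z → V} (hc : Continuous c)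
    (H : ∀ z, ∃ i, c z ∈ P.U i ∧ ∀ᶠ z' in 𝓝 z, g z' - g z = P.h i (c z') - P.h i (c z)) :
    P.IsPrimitiveAlong c g := by
  intro z j hj
  obtain ⟨i, hi, hg⟩ := H z
  filter_upwards [hg, hc.continuousAt.eventually (P.compat i j (c z) ⟨hi, hj⟩)] with z' h1 h2
  rw [h1]
  rw [sub_eq_sub_iff_add_eq_add] at h2 ⊢
  rw [add_comm (P.h j (c z')), ← h2]

namespace IsPrimitiveAlong

theorem comp {c : Z → X} {g : Z → V} (hg : P.IsPrimitiveAlong c g) {k : Z' → Z}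
    (hk : Continuous k) : P.IsPrimitiveAlong (c ∘ k) (g ∘ k) :=
  fun z i hi => hk.continuousAt.eventually (hg (k z) i hi)

theorem of_mapsTo {c : Z → X} (i : X) (hc : ∀ z, c z ∈ P.U i) (hcont : Continuous c) :
    P.IsPrimitiveAlong c (fun z => P.h i (c z)) :=
  isPrimitiveAlong_of_exists hcont fun z => ⟨i, hc z, .of_forall fun _ => rfl⟩

theorem sub_eq_sub {c : Z → X} {g g' : Z → V} [PreconnectedSpace Z]
    (hg : P.IsPrimitiveAlong c g) (hg' : P.IsPrimitiveAlong c g') (z w : Z) :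
    g z - g w = g' z - g' w := by
  have hlc : IsLocallyConstant (fun z => g z - g' z) := by
    rw [IsLocallyConstant.iff_eventually_eq]
    intro z
    filter_upwards [hg z (c z) (P.mem_U _), hg' z (c z) (P.mem_U _)] with z' h1 h2
    have h3 := h1.trans h2.symm
    rw [sub_eq_sub_iff_add_eq_add] at h3 ⊢
    rw [h3, add_comm]
  have := hlc.apply_eq_of_preconnectedSpace z w
  rw [sub_eq_sub_iff_add_eq_add] at this ⊢
  rw [this, add_comm]

end IsPrimitiveAlong

variable (P)

/-- The covering space of germs of primitives. -/
def bundleCore [TopologicalSpace V] [DiscreteTopology V] : FiberBundleCore X X V where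
  baseSet := P.U
  isOpen_baseSet := P.isOpen_U
  indexAt := id
  mem_baseSet_at := P.mem_U
  -- The coordinate `v` in the chart `i` is the constant by which a germ exceeds `h i`.
  coordChange i j x v := v + (P.h i x - P.h j x)
  coordChange_self i x _ v := by simp
  continuousOn_coordChange i j := by
    rintro ⟨x, v⟩ ⟨hx, -⟩
    apply ContinuousAt.continuousWithinAt
    have h1 : ∀ᶠ q : X × V in 𝓝 (x, v), P.h i q.1 - P.h j q.1 = P.h i x - P.h j x :=
      (continuous_fst.tendsto (x, v)).eventually (P.compat i j x hx)
    have h2 : ∀ᶠ q : X × V in 𝓝 (x, v), q.2 = v :=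
      (continuous_snd.tendsto (x, v)).eventually
        (by simp [nhds_discrete] : ∀ᶠ w in 𝓝 v, w = v)
    refine (continuousAt_const (y := v + (P.h i x - P.h j x))).congr ?_
    filter_upwards [h1, h2] with q hq1 hq2
    rw [hq1, hq2]
  coordChange_comp i j k x _ v := by abel

/-- Monodromy: `c` lifts to the covering space of germs, and the lift, read as a function, is the
primitive. -/
theorem exists_isPrimitiveAlong [SimplyConnectedSpace Z] [LocallyPathConnectedSpace Z]
    (c : C(Z, X)) : ∃ g : Z → V, P.IsPrimitiveAlong c g := by
  -- The discrete topology on the fibre is what makes the bundle a covering.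
  let : TopologicalSpace V := ⊥
  have : DiscreteTopology V := ⟨rfl⟩
  let B := P.bundleCore
  have cov : IsCoveringMap (Bundle.TotalSpace.proj : Bundle.TotalSpace V B.Fiber → X) :=
    FiberBundle.isCoveringMap
  obtain ⟨z₀⟩ : Nonempty Z := inferInstance
  obtain ⟨F, ⟨-, hF⟩, -⟩ := cov.existsUnique_continuousMap_lifts c z₀
    (⟨c z₀, (0 : V)⟩ : Bundle.TotalSpace V B.Fiber) rfl
  have hFc : ∀ z, (F z).proj = c z := fun z => congrFun hF z
  let w : Z → V := fun z => (F z).snd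
  -- `w z` is the coordinate of the lifted germ in the chart with index `c z`; adding the local
  -- primitive of that index gives the value of the germ.
  refine ⟨fun z => w z + P.h (c z) (c z), fun z i hi => ?_⟩
  have hsrc : F z ∈ (B.localTriv i).source := by
    rw [FiberBundleCore.mem_localTriv_source]
    change (F z).proj ∈ P.U i
    rwa [hFc]
  have hcont : ContinuousAt (fun z' => ((B.localTriv i) (F z')).2) z :=
    continuous_snd.continuousAt.comp
      (((B.localTriv i).continuousAt hsrc).comp F.continuous.continuousAt)
  have hev : ∀ᶠ z' in 𝓝 z, ((B.localTriv i) (F z')).2 = ((B.localTriv i) (F z)).2 :=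
    hcont.eventually (by simp [nhds_discrete] :
      ∀ᶠ w in 𝓝 ((B.localTriv i) (F z)).2, w = ((B.localTriv i) (F z)).2)
  filter_upwards [hev] with z' hz'
  have hval : ∀ y, ((B.localTriv i) (F y)).2 = w y + (P.h (c y) (c y) - P.h i (c y)) := by
    intro y
    rw [← hFc y]
    rfl
  rw [hval, hval, ← sub_eq_zero] at hz'
  rw [← sub_eq_zero, ← hz']
  abel

instance : LocallyPathConnectedSpace unitInterval :=
  (convex_Icc (0 : ℝ) 1).locallyPathConnectedSpace_coe

instance : ContractibleSpace unitInterval :=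
  (convex_Icc (0 : ℝ) 1).contractibleSpace ⟨0, by simp⟩

/-- The integral along a path. -/
def pathIntegral {x y : X} (γ : Path x y) : V :=
  let g := (P.exists_isPrimitiveAlong γ.toContinuousMap).choose
  g 1 - g 0

variable {P}

theorem IsPrimitiveAlong.pathIntegral_eq {x y : X} {γ : Path x y} {g : unitInterval → V}
    (hg : P.IsPrimitiveAlong γ g) : P.pathIntegral γ = g 1 - g 0 :=
  (P.exists_isPrimitiveAlong γ.toContinuousMap).choose_spec.sub_eq_sub hg 1 0

theorem IsPrimitiveAlong.pathIntegral_map {c : C(Z, X)} {g : Z → V}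
    (hg : P.IsPrimitiveAlong c g) {z w : Z} (γ : Path z w) :
    P.pathIntegral (γ.map c.continuous) = g w - g z := by
  have : P.IsPrimitiveAlong (γ.map c.continuous) (g ∘ γ) := hg.comp γ.continuous
  rw [this.pathIntegral_eq]
  simp

variable (P)

theorem pathIntegral_cast {x y x' y' : X} (γ : Path x y) (hx : x' = x) (hy : y' = y) :
    P.pathIntegral (γ.cast hx hy) = P.pathIntegral γ := by
  subst hx hy
  rfl

theorem pathIntegral_trans {x y z : X} (γ : Path x y) (γ' : Path y z) :
    P.pathIntegral (γ.trans γ') = P.pathIntegral γ + P.pathIntegral γ' := by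
  obtain ⟨g, hg⟩ := P.exists_isPrimitiveAlong (γ.trans γ').toContinuousMap
  let l : unitInterval → unitInterval := fun t =>
    ⟨t / 2, by have := t.2.1; linarith, by have := t.2.2; linarith⟩
  let r : unitInterval → unitInterval := fun t =>
    ⟨(t + 1) / 2, by have := t.2.1; linarith, by have := t.2.2; linarith⟩
  have hl : Continuous l := by unfold l; fun_prop
  have hr : Continuous r := by unfold r; fun_prop
  have h1 : P.IsPrimitiveAlong γ (g ∘ l) := by
    have : (γ : unitInterval → X) = (γ.trans γ').toContinuousMap ∘ l := by
      ext t
      have h2 : (t : ℝ) / 2 ≤ 1 / 2 := by have := t.2.2; linarith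
      change _ = (γ.trans γ') (l t)
      rw [Path.trans_apply, dif_pos h2]
      congr 1
      ext
      simp only [l]
      ring
    rw [this]
    exact hg.comp hl
  have h2 : P.IsPrimitiveAlong γ' (g ∘ r) := by
    have : (γ' : unitInterval → X) = (γ.trans γ').toContinuousMap ∘ r := by
      ext t
      change _ = (γ.trans γ') (r t)
      -- At `t = 0` the parameter `r t = 1 / 2` still falls in the branch of `γ`.
      rcases eq_or_lt_of_le t.2.1 with h0 | h0
      · have ht : t = 0 := Subtype.ext h0.symm
        have h2 : ((r t : unitInterval) : ℝ) ≤ 1 / 2 := by simp [r, ht]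
        rw [Path.trans_apply, dif_pos h2]
        have : (⟨2 * ((r t : unitInterval) : ℝ), (unitInterval.mul_pos_mem_iff zero_lt_two).2
            ⟨(r t).2.1, h2⟩⟩ : unitInterval) = 1 := by
          ext; simp [r, ht]
        rw [this, ht, γ'.source, γ.target]
      · have h2 : ¬ ((r t : unitInterval) : ℝ) ≤ 1 / 2 := by
          simp only [r, not_le]
          linarith
        rw [Path.trans_apply, dif_neg h2]
        congr 1
        ext
        simp only [r]
        ring
    rw [this]
    exact hg.comp hr
  have h3 : P.IsPrimitiveAlong (γ.trans γ') g := hg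
  rw [h1.pathIntegral_eq, h2.pathIntegral_eq, h3.pathIntegral_eq]
  have e1 : l 1 = r 0 := by ext; simp [l, r]
  have e2 : l 0 = 0 := by ext; simp [l]
  have e3 : r 1 = 1 := by ext; simp [r]
  simp only [Function.comp_apply, e1, e2, e3]
  abel

/-- A primitive `G` along the whole homotopy square computes both integrals, and `G` is constant on
the two sides where the homotopy is. -/
theorem pathIntegral_eq_of_homotopic {x y : X} {γ γ' : Path x y} (H : γ.Homotopic γ') :
    P.pathIntegral γ = P.pathIntegral γ' := by
  obtain ⟨H⟩ := H
  obtain ⟨G, hG⟩ := P.exists_isPrimitiveAlong H.toContinuousMap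
  have hconst : ∀ (t : unitInterval) (a : X), (∀ s, H (s, t) = a) → G (0, t) = G (1, t) := by
    intro t a ha
    have h1 : P.IsPrimitiveAlong (fun _ : unitInterval => a) (fun s => G (s, t)) := by
      have : (fun _ : unitInterval => a) = H.toContinuousMap ∘ fun s => (s, t) := by
        ext s; exact (ha s).symm
      rw [this]
      exact hG.comp (by fun_prop)
    have h2 := h1.sub_eq_sub (g' := fun _ => P.h a a)
      (IsPrimitiveAlong.of_mapsTo a (fun _ => P.mem_U a) continuous_const) 0 1
    simpa [sub_eq_zero] using h2
  have h0 := hconst 0 x (fun s => H.source s)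
  have h1 := hconst 1 y (fun s => H.target s)
  have hs : ∀ (s : unitInterval) (η : Path x y), (∀ t, H (s, t) = η t) →
      P.pathIntegral η = G (s, 1) - G (s, 0) := by
    intro s η hη
    have : P.IsPrimitiveAlong η (fun t => G (s, t)) := by
      have : (η : unitInterval → X) = H.toContinuousMap ∘ fun t => (s, t) := by
        ext t; exact (hη t).symm
      rw [this]
      exact hG.comp (by fun_prop)
    exact this.pathIntegral_eq
  rw [hs 0 γ fun t => H.apply_zero t, hs 1 γ' fun t => H.apply_one t, h0, h1]

/-- The integral as a homomorphism on the fundamental group. -/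
def fundamentalGroupHom (x : X) : FundamentalGroup X x →* Multiplicative V :=
  MonoidHom.mk' (fun γ => Multiplicative.ofAdd
    (Quotient.lift (fun γ : Path x x => P.pathIntegral γ)
      (fun _ _ h => P.pathIntegral_eq_of_homotopic h) γ)) <| by
    rintro ⟨γ⟩ ⟨γ'⟩
    -- The product of the fundamental group concatenates in the opposite order.
    rw [mul_comm, ← ofAdd_add]
    exact congrArg Multiplicative.ofAdd (P.pathIntegral_trans γ' γ)

/-- A homomorphism to an abelian group kills commutators. -/
theorem pathIntegral_map_eq_zero {Y : Type*} [TopologicalSpace Y] {p : C(Y, X)} {y : Y}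
    (hp : (FundamentalGroup.map p y).range ≤ commutator (FundamentalGroup X (p y)))
    (γ : Path y y) : P.pathIntegral (γ.map p.continuous) = 0 := by
  have h1 : FundamentalGroup.map p y (FundamentalGroup.fromPath (.mk γ)) ∈
      (P.fundamentalGroupHom (p y)).ker :=
    Abelianization.commutator_subset_ker _ (hp ⟨_, rfl⟩)
  exact Multiplicative.ofAdd.injective (MonoidHom.mem_ker.1 h1)

/-- Integration from a base point does not depend on the path, since projected loops have integral
zero. Near `y`, paths may be chosen inside one member of the cover. -/
theorem exists_isPrimitiveAlong_of_range_le {Y : Type*} [TopologicalSpace Y] [PathConnectedSpace Y]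
    [LocallyPathConnectedSpace Y] (p : C(Y, X))
    (hp : ∀ y, (FundamentalGroup.map p y).range ≤ commutator (FundamentalGroup X (p y))) :
    ∃ g : Y → V, P.IsPrimitiveAlong p g := by
  obtain ⟨y₀⟩ : Nonempty Y := inferInstance
  let pt : ∀ y, Path y₀ y := fun y => PathConnectedSpace.somePath y₀ y
  refine ⟨fun y => P.pathIntegral ((pt y).map p.continuous), isPrimitiveAlong_of_exists
    p.continuous fun y => ⟨p y, P.mem_U _, ?_⟩⟩
  obtain ⟨W, ⟨hW, hWc⟩, hWU⟩ := (path_connected_basis y).mem_iff.1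
    (((P.isOpen_U (p y)).preimage p.continuous).mem_nhds (P.mem_U _))
  filter_upwards [hW] with z hz
  obtain ⟨γ, hγ⟩ := hWc.joinedIn y (mem_of_mem_nhds hW) z hz
  have h1 : P.pathIntegral (γ.map p.continuous) = P.h (p y) (p z) - P.h (p y) (p y) := by
    have := IsPrimitiveAlong.of_mapsTo (P := P) (c := γ.map p.continuous) (p y)
      (fun t => hWU (hγ t)) (γ.map p.continuous).continuous
    rw [this.pathIntegral_eq]
    simp
  have h2 := P.pathIntegral_map_eq_zero (hp y₀) (((pt y).trans γ).trans (pt z).symm)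
  have h3 : P.pathIntegral ((pt z).map p.continuous) +
      P.pathIntegral ((pt z).symm.map p.continuous) = 0 := by
    rw [← pathIntegral_trans, ← Path.map_trans]
    exact P.pathIntegral_map_eq_zero (hp y₀) _
  rw [Path.map_trans, Path.map_trans, pathIntegral_trans, pathIntegral_trans] at h2
  rw [← h1, ← sub_eq_zero]
  have := h2.trans h3.symm
  have h4 := add_right_cancel this
  rw [← h4]
  abel

end LocalPrimitives

/-! ### The integral on first homology -/

namespace LocalPrimitives

variable {X : Type u} [TopologicalSpace X]

section Simplex

variable {V : Type*} [AddCommGroup V] (P : LocalPrimitives X V)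

instance {n : ℕ} : LocallyPathConnectedSpace (stdSimplex ℝ (Fin (n + 1))) :=
  (convex_stdSimplex ℝ (Fin (n + 1))).locallyPathConnectedSpace_coe

instance {n : ℕ} : ContractibleSpace (stdSimplex ℝ (Fin (n + 1))) :=
  (convex_stdSimplex ℝ (Fin (n + 1))).contractibleSpace ⟨_, single_mem_stdSimplex ℝ 0⟩

/-- The integral along a singular 1-simplex. -/
def simplexIntegral (s : (TopCat.toSSet.obj (TopCat.of X)) _⦋1⦌) : V :=
  let g := (P.exists_isPrimitiveAlong ((TopCat.of X).toSSetObjEquiv (.op ⦋1⦌) s)).choose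
  g (stdSimplex.vertex 1) - g (stdSimplex.vertex 0)

variable {P}

theorem IsPrimitiveAlong.simplexIntegral_eq {s : (TopCat.toSSet.obj (TopCat.of X)) _⦋1⦌}
    {g : stdSimplex ℝ (Fin 2) → V}
    (hg : P.IsPrimitiveAlong ((TopCat.of X).toSSetObjEquiv (.op ⦋1⦌) s) g) :
    P.simplexIntegral s = g (stdSimplex.vertex 1) - g (stdSimplex.vertex 0) :=
  (P.exists_isPrimitiveAlong ((TopCat.of X).toSSetObjEquiv (.op ⦋1⦌) s)).choose_spec.sub_eq_sub
    hg _ _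

variable (P)

theorem simplexIntegral_pathSimplex {x y : X} (γ : Path x y) :
    P.simplexIntegral (pathSimplex γ) = P.pathIntegral γ := by
  obtain ⟨g, hg⟩ := P.exists_isPrimitiveAlong γ.toContinuousMap
  have h1 : P.IsPrimitiveAlong γ g := hg
  have h2 : P.IsPrimitiveAlong ((TopCat.of X).toSSetObjEquiv (.op ⦋1⦌) (pathSimplex γ))
      (g ∘ stdSimplexHomeomorphUnitInterval) :=
    hg.comp stdSimplexHomeomorphUnitInterval.continuous
  rw [h1.pathIntegral_eq, h2.simplexIntegral_eq]
  have e0 : stdSimplexHomeomorphUnitInterval (stdSimplex.vertex 0) = 0 :=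
    stdSimplexHomeomorphUnitInterval_zero
  have e1 : stdSimplexHomeomorphUnitInterval (stdSimplex.vertex 1) = 1 :=
    stdSimplexHomeomorphUnitInterval_one
  simp only [Function.comp_apply, e0, e1]

/-- The 2-simplex is contractible, so it carries a single primitive; the integrals over the faces
are differences of its values at the vertices and cancel. -/
theorem simplexIntegral_boundary (s : (TopCat.toSSet.obj (TopCat.of X)) _⦋2⦌) :
    P.simplexIntegral ((TopCat.toSSet.obj (TopCat.of X)).δ 0 s) -
      P.simplexIntegral ((TopCat.toSSet.obj (TopCat.of X)).δ 1 s) +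
      P.simplexIntegral ((TopCat.toSSet.obj (TopCat.of X)).δ 2 s) = 0 := by
  obtain ⟨G, hG⟩ := P.exists_isPrimitiveAlong ((TopCat.of X).toSSetObjEquiv (.op ⦋2⦌) s)
  have key : ∀ i : Fin 3, P.simplexIntegral ((TopCat.toSSet.obj (TopCat.of X)).δ i s) =
      G (stdSimplex.vertex (i.succAbove 1)) - G (stdSimplex.vertex (i.succAbove 0)) := by
    intro i
    have : P.IsPrimitiveAlong ((TopCat.of X).toSSetObjEquiv (.op ⦋1⦌)
        ((TopCat.toSSet.obj (TopCat.of X)).δ i s)) (G ∘ stdSimplex.map (Fin.succAbove i)) :=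
      hG.comp (stdSimplex.continuous_map _)
    rw [this.simplexIntegral_eq]
    simp only [Function.comp_apply]
    rw [stdSimplex.map_vertex, stdSimplex.map_vertex]
  rw [key, key, key]
  have e : (0 : Fin 3).succAbove (1 : Fin 2) = 2 ∧ (0 : Fin 3).succAbove (0 : Fin 2) = 1 ∧
      (1 : Fin 3).succAbove (1 : Fin 2) = 2 ∧ (1 : Fin 3).succAbove (0 : Fin 2) = 0 ∧
      (2 : Fin 3).succAbove (1 : Fin 2) = 1 ∧ (2 : Fin 3).succAbove (0 : Fin 2) = 0 := by decide
  obtain ⟨e1, e2, e3, e4, e5, e6⟩ := e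
  rw [e1, e2, e3, e4, e5, e6]
  abel

end Simplex

variable (P : LocalPrimitives X ℝ)

/-- The value of the cochain on a simplex. -/
def cochainAt (r : ℝ) : intCoeff.{u} ⟶ ModuleCat.of ℤ (ULift.{u} ℝ) :=
  ModuleCat.ofHom
    ((LinearMap.toSpanSingleton ℤ (ULift.{u} ℝ) (ULift.up r)).comp ULift.moduleEquiv.toLinearMap)

theorem cochainAt_apply (r : ℝ) : (cochainAt.{u} r).hom (ULift.up 1) = ULift.up r := by
  simp [cochainAt]

theorem hom_ext_intCoeff {A : ModuleCat.{u} ℤ} {φ ψ : intCoeff.{u} ⟶ A}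
    (h : φ.hom (ULift.up 1) = ψ.hom (ULift.up 1)) : φ = ψ := by
  ext ⟨n⟩
  have : (ULift.up n : ULift.{u} ℤ) = n • ULift.up 1 := by ext; simp
  rw [this]
  simp only [map_zsmul]
  rw [h]

/-- The singular cochain of integrals along 1-simplices. -/
def cochain : ((TopCat.toSSet.obj (TopCat.of X)).chainComplex intCoeff.{u}).X 1 ⟶
    ModuleCat.of ℤ (ULift.{u} ℝ) :=
  Limits.Cofan.IsColimit.desc ((TopCat.toSSet.obj (TopCat.of X)).isColimitChainComplexXCofan _ 1)
    fun s => cochainAt (P.simplexIntegral s)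

theorem ι_cochain (s : (TopCat.toSSet.obj (TopCat.of X)) _⦋1⦌) :
    (TopCat.toSSet.obj (TopCat.of X)).ιChainComplex s ≫ P.cochain =
      cochainAt (P.simplexIntegral s) :=
  Limits.Cofan.IsColimit.fac
    ((TopCat.toSSet.obj (TopCat.of X)).isColimitChainComplexXCofan intCoeff.{u} 1) _ s

theorem d_cochain :
    ((TopCat.toSSet.obj (TopCat.of X)).chainComplex intCoeff.{u}).d 2 1 ≫ P.cochain = 0 := by
  refine SSet.chainComplex_hom_ext fun s => ?_
  rw [SSet.ιChainComplex_d_assoc, Limits.comp_zero]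
  rw [Preadditive.sum_comp, Fin.sum_univ_three]
  simp only [Preadditive.zsmul_comp, ι_cochain]
  apply hom_ext_intCoeff
  have := P.simplexIntegral_boundary s
  have h : ∀ r : ℝ, ((cochainAt.{u} r).hom (ULift.up 1)).down = r := fun r =>
    congrArg ULift.down (cochainAt_apply r)
  ext
  simp only [Fin.val_zero, pow_zero, one_smul, Fin.val_one, pow_one, neg_smul, Fin.val_two,
    even_two, Even.neg_pow, one_pow, ModuleCat.hom_add, ModuleCat.hom_neg, LinearMap.add_apply,
    LinearMap.neg_apply, ULift.add_down, ULift.neg_down]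
  erw [h, h, h]
  rw [← sub_eq_add_neg]
  exact this

/-- The integral on first homology. -/
def homologyIntegral : H1 X →ₗ[ℤ] ULift.{u} ℝ :=
  (((TopCat.toSSet.obj (TopCat.of X)).chainComplex intCoeff.{u}).homologyι 1 ≫
    ((TopCat.toSSet.obj (TopCat.of X)).chainComplex intCoeff.{u}).descOpcycles P.cochain 2
      (by simp) P.d_cochain).hom

theorem homologyIntegral_loopClass {x : X} (γ : Path x x) :
    (P.homologyIntegral (loopClass γ)).down = P.pathIntegral γ := by
  have h : ∀ (h0 : _ = _) (h : _ = _),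
      (((TopCat.toSSet.obj (TopCat.of X)).chainComplex intCoeff.{u}).liftCycles
        ((TopCat.toSSet.obj (TopCat.of X)).ιChainComplex (pathSimplex γ)) 0 h0 h ≫
      ((TopCat.toSSet.obj (TopCat.of X)).chainComplex intCoeff.{u}).homologyπ 1) ≫
      (((TopCat.toSSet.obj (TopCat.of X)).chainComplex intCoeff.{u}).homologyι 1 ≫
      ((TopCat.toSSet.obj (TopCat.of X)).chainComplex intCoeff.{u}).descOpcycles P.cochain 2
      (by simp) P.d_cochain) = cochainAt (P.simplexIntegral (pathSimplex γ)) := by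
    intro h0 h
    rw [Category.assoc, HomologicalComplex.homology_π_ι_assoc,
      HomologicalComplex.liftCycles_i_assoc, HomologicalComplex.p_descOpcycles, ι_cochain]
  rw [← simplexIntegral_pathSimplex]
  exact congrArg ULift.down ((congrArg (fun φ => φ.hom (ULift.up 1)) (h _ _)).trans
    (cochainAt_apply _))

end LocalPrimitives

theorem H1map_loopClass {X : Type u} [TopologicalSpace X] (f : C(X, X)) {x : X} (γ : Path x x) :
    H1map f (loopClass γ) = loopClass (γ.map f.continuous) := by
  let S := TopCat.toSSet.obj (TopCat.of X)
  let K := S.chainComplex intCoeff.{u}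
  let F : S ⟶ S := TopCat.toSSet.map (TopCat.ofHom f)
  have h : ∀ (h0 : _ = _) (h : _ = _) (h' : _ = _),
      (K.liftCycles (S.ιChainComplex (pathSimplex γ)) 0 h0 h ≫ K.homologyπ 1) ≫
        HomologicalComplex.homologyMap (SSet.chainComplexMap F intCoeff.{u}) 1 =
      K.liftCycles (S.ιChainComplex (pathSimplex (γ.map f.continuous))) 0 h0 h' ≫
        K.homologyπ 1 := by
    intro h0 h h'
    rw [Category.assoc, HomologicalComplex.homologyπ_naturality, ← Category.assoc]
    congr 1
    rw [HomologicalComplex.liftCycles_comp_cyclesMap]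
    congr 1
    exact SSet.ι_chainComplexMap_f _ _ F _ _
  exact congrArg (fun φ => φ.hom (ULift.up 1)) (h _ _ _)

/-! ### Local primitives of smooth closed one-forms -/

section Manifold

variable {d : ℕ} {M : Type u} [TopologicalSpace M] [ChartedSpace (EuclideanSpace ℝ (Fin d)) M]

/-- The local primitives `P` are smooth with differential `θ`. -/
structure LocalPrimitives.IsPrimitiveOf (P : LocalPrimitives M ℝ) (θ : OneForm d M) : Prop where
  contMDiffOn : ∀ m, ContMDiffOn (𝓡 d) 𝓘(ℝ, ℝ) ∞ (P.h m) (P.U m)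
  hasMFDerivAt : ∀ m, ∀ y ∈ P.U m, HasMFDerivAt (𝓡 d) 𝓘(ℝ, ℝ) (P.h m) y (θ y)

/-- The Poincaré lemma on a ball. The potential is smooth because its derivative is. -/
theorem OneForm.IsSmoothClosed.exists_primitive_inChart {θ : OneForm d M} (hθ : θ.IsSmoothClosed)
    (c : M) : ∃ r > 0, ∃ ψ : EuclideanSpace ℝ (Fin d) → ℝ,
      Metric.ball (chartAt (EuclideanSpace ℝ (Fin d)) c c) r ⊆
        (chartAt (EuclideanSpace ℝ (Fin d)) c).target ∧
      ContDiffOn ℝ ∞ ψ (Metric.ball (chartAt (EuclideanSpace ℝ (Fin d)) c c) r) ∧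
      ∀ y ∈ Metric.ball (chartAt (EuclideanSpace ℝ (Fin d)) c c) r,
        HasFDerivAt ψ (θ.inChart c y) y := by
  set e := chartAt (EuclideanSpace ℝ (Fin d)) c
  obtain ⟨r, hr, hball⟩ := Metric.isOpen_iff.1 e.open_target (e c)
    (e.map_source (mem_chart_source _ c))
  have hsm := (hθ.smooth c).mono hball
  obtain ⟨ψ, hψ⟩ := (convex_ball (e c) r).exists_forall_hasFDerivAt_of_fderiv_symmetric
    Metric.isOpen_ball (hsm.differentiableOn (by simp))
    (fun a ha x y => sub_eq_zero.1 (hθ.closed c a (hball ha) x y))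
  refine ⟨r, hr, ψ, hball, ?_, hψ⟩
  rw [contDiffOn_infty_iff_fderiv_of_isOpen Metric.isOpen_ball]
  exact ⟨fun y hy => (hψ y hy).differentiableAt.differentiableWithinAt,
    hsm.congr fun y hy => (hψ y hy).fderiv⟩

/-- The fundamental theorem of calculus: along a smooth curve the continued primitive is `C¹` with
the integrand as derivative. -/
theorem LocalPrimitives.IsPrimitiveOf.lineIntegral_eq {P : LocalPrimitives M ℝ} {θ : OneForm d M}
    (hP : P.IsPrimitiveOf θ) {c : ℝ → M} (hc : IsSmoothCurve d c) {g : unitInterval → ℝ}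
    (hg : P.IsPrimitiveAlong (fun t : unitInterval => c t) g) :
    θ.lineIntegral c = g 1 - g 0 := by
  let G : ℝ → ℝ := IccExtend zero_le_one g
  have hG : ∀ t ∈ Icc (0 : ℝ) 1, ∀ m, c t ∈ P.U m →
      ∀ᶠ s in 𝓝[Icc 0 1] t, G s = P.h m (c s) + (G t - P.h m (c t)) := by
    intro t ht m hm
    have h1 := (eventually_nhds_subtype_iff (Icc (0 : ℝ) 1) ⟨t, ht⟩
      (fun s => G s - G t = P.h m (c s) - P.h m (c t))).1 <| by
        filter_upwards [hg ⟨t, ht⟩ m hm] with s hs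
        have hGt : G t = g ⟨t, ht⟩ := IccExtend_of_mem _ g ht
        have hGs : G s = g s := IccExtend_val _ g s
        rw [hGt, hGs]
        exact hs
    filter_upwards [h1] with s hs
    linarith
  have hsmooth : ContDiffOn ℝ 1 G (Icc 0 1) := by
    intro t ht
    rw [← contMDiffWithinAt_iff_contDiffWithinAt]
    have hm := P.mem_U (c t)
    have h1 : ContMDiffWithinAt 𝓘(ℝ, ℝ) 𝓘(ℝ, ℝ) ∞ (P.h (c t) ∘ c) (Icc 0 1) t :=
      (hP.contMDiffOn (c t) |>.contMDiffAt ((P.isOpen_U _).mem_nhds hm)).comp_contMDiffWithinAt t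
        (hc t ht)
    have h2 : ContMDiffWithinAt 𝓘(ℝ, ℝ) 𝓘(ℝ, ℝ) 1
        (fun s => P.h (c t) (c s) + (G t - P.h (c t) (c t))) (Icc 0 1) t :=
      (h1.of_le (by simp)).add contMDiffWithinAt_const
    exact h2.congr_of_eventuallyEq (hG t ht _ hm) (by simp)
  have hder : ∀ t ∈ Ioo (0 : ℝ) 1,
      HasDerivAt G (θ (c t) (mfderiv 𝓘(ℝ, ℝ) (𝓡 d) c t (1 : ℝ))) t := by
    intro t ht
    have hm := P.mem_U (c t)
    have hI : Icc (0 : ℝ) 1 ∈ 𝓝 t := Icc_mem_nhds ht.1 ht.2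
    have h1 := hG t (Ioo_subset_Icc_self ht) _ hm
    rw [nhdsWithin_eq_nhds.2 hI] at h1
    have h2 : HasMFDerivAt 𝓘(ℝ, ℝ) (𝓡 d) c t (mfderiv 𝓘(ℝ, ℝ) (𝓡 d) c t) :=
      ((hc.contMDiffAt hI).mdifferentiableAt (by simp)).hasMFDerivAt
    have h3 := (hP.hasMFDerivAt (c t) (c t) hm).comp t h2
    let D : ℝ →L[ℝ] ℝ := ContinuousLinearMap.comp (θ (c t) : EuclideanSpace ℝ (Fin d) →L[ℝ] ℝ)
      (mfderiv 𝓘(ℝ, ℝ) (𝓡 d) c t : ℝ →L[ℝ] EuclideanSpace ℝ (Fin d))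
    have h4 : HasFDerivAt (P.h (c t) ∘ c) D t := hasMFDerivAt_iff_hasFDerivAt.1 h3
    exact (h4.hasDerivAt.add_const _).congr_of_eventuallyEq h1
  -- The integrand agrees with the continuous `derivWithin` of `G` on the open interval. At the
  -- endpoints `mfderiv` may take its default value, which does not affect integrability.
  have hint : IntervalIntegrable (fun t => θ (c t) (mfderiv 𝓘(ℝ, ℝ) (𝓡 d) c t (1 : ℝ)))
      MeasureTheory.volume 0 1 := by
    have h1 : ContinuousOn (derivWithin G (Icc 0 1)) (Icc 0 1) :=
      hsmooth.continuousOn_derivWithin (uniqueDiffOn_Icc zero_lt_one) le_rfl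
    refine (h1.intervalIntegrable_of_Icc zero_le_one).congr_uIoo fun t ht => ?_
    rw [uIoo_of_le zero_le_one] at ht
    rw [derivWithin_of_mem_nhds (Icc_mem_nhds ht.1 ht.2), (hder t ht).deriv]
  have := intervalIntegral.integral_eq_sub_of_hasDerivAt_of_le zero_le_one
    hsmooth.continuousOn hder hint
  rw [OneForm.lineIntegral, this]
  simp [G]

/-! ### Smooth paths in a covering space -/

variable {E : Type v} [TopologicalSpace E]

variable (d) in
/-- The points `x` and `y` are joined by a path whose projection is smooth. -/
def SmoothlyJoined (p : C(E, M)) (x y : E) : Prop :=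
  ∃ γ : Path x y, IsSmoothCurve d (p ∘ γ.extend)

theorem SmoothlyJoined.symm {p : C(E, M)} {x y : E} (h : SmoothlyJoined d p x y) :
    SmoothlyJoined d p y x := by
  obtain ⟨γ, hγ⟩ := h
  refine ⟨γ.symm, ?_⟩
  have h1 : p ∘ γ.symm.extend = (p ∘ γ.extend) ∘ fun t : ℝ => 1 - t := by
    ext t
    simp
  rw [IsSmoothCurve, h1]
  refine ContMDiffOn.comp (t := Icc 0 1) hγ ?_ fun t ht => ?_
  · exact (contMDiff_iff_contDiff.2 (contDiff_const.sub contDiff_id)).contMDiffOn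
  · exact ⟨by linarith [ht.2], by linarith [ht.1]⟩

theorem IsSmoothCurve.contMDiff_comp_smoothTransition {c : ℝ → M} (hc : IsSmoothCurve d c)
    {k : ℝ → ℝ} (hk : ContDiff ℝ ∞ k) :
    ContMDiff 𝓘(ℝ, ℝ) (𝓡 d) ∞ (fun t => c (Real.smoothTransition (k t))) := by
  rw [← contMDiffOn_univ]
  refine ContMDiffOn.comp (t := Icc 0 1) hc ?_
    fun t _ => ⟨Real.smoothTransition.nonneg _, Real.smoothTransition.le_one _⟩
  exact (contMDiff_iff_contDiff.2 (Real.smoothTransition.contDiff.comp hk)).contMDiffOn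

theorem SmoothlyJoined.trans {p : C(E, M)} {x y z : E} (h : SmoothlyJoined d p x y)
    (h' : SmoothlyJoined d p y z) : SmoothlyJoined d p x z := by
  obtain ⟨γ, hγ⟩ := h
  obtain ⟨γ', hγ'⟩ := h'
  -- The first curve rests at `y` from time `1 / 3` on and the second one up to `2 / 3`; they agree
  -- on an interval around `1 / 2`, so the junction is smooth.
  let a : ℝ → E := fun t => γ.extend (Real.smoothTransition (3 * t))
  let a' : ℝ → E := fun t => γ'.extend (Real.smoothTransition (3 * t - 2))
  have ha : Continuous a :=
    γ.continuous_extend.comp (Real.smoothTransition.continuous.comp (by fun_prop))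
  have ha' : Continuous a' :=
    γ'.continuous_extend.comp (Real.smoothTransition.continuous.comp (by fun_prop))
  have ha1 : ∀ t, 1 / 3 ≤ t → a t = y := fun t ht => by
    simp only [a]
    rw [Real.smoothTransition.one_of_one_le (by linarith), γ.extend_one]
  have ha0 : ∀ t, t ≤ 2 / 3 → a' t = y := fun t ht => by
    simp only [a']
    rw [Real.smoothTransition.zero_of_nonpos (by linarith), γ'.extend_zero]
  let η : ℝ → E := fun t => if t ≤ 1 / 2 then a t else a' t
  have hη : Continuous η := ha.if_le ha' continuous_id continuous_const fun t ht => by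
    rw [ha1 t (by rw [ht]; norm_num), ha0 t (by rw [ht]; norm_num)]
  have hηl : ∀ t, t < 2 / 3 → η t = a t := fun t ht => by
    simp only [η]
    split_ifs with h
    · rfl
    · rw [ha0 t ht.le, ha1 t (by linarith)]
  have hηr : ∀ t, 1 / 3 < t → η t = a' t := fun t ht => by
    simp only [η]
    split_ifs with h
    · rw [ha0 t (by linarith), ha1 t ht.le]
    · rfl
  have h0 : η 0 = x := by
    rw [hηl 0 (by norm_num)]
    simp [a]
  have h1 : η 1 = z := by
    rw [hηr 1 (by norm_num)]
    have : (3 * 1 - 2 : ℝ) = 1 := by norm_num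
    simp only [a']
    rw [this, Real.smoothTransition.one, γ'.extend_one]
  let ζ : Path x z := ⟨⟨fun t => η t, by fun_prop⟩, by simpa using h0, by simpa using h1⟩
  refine ⟨ζ, ?_⟩
  have hsm : ContMDiff 𝓘(ℝ, ℝ) (𝓡 d) ∞ (p ∘ η) := by
    intro t
    rcases lt_or_ge t (2 / 3) with ht | ht
    · refine ((hγ.contMDiff_comp_smoothTransition (k := fun t => 3 * t) (by fun_prop))
        t).congr_of_eventuallyEq ?_
      filter_upwards [Iio_mem_nhds ht] with s hs
      exact congrArg p (hηl s hs)
    · refine ((hγ'.contMDiff_comp_smoothTransition (k := fun t => 3 * t - 2) (by fun_prop))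
        t).congr_of_eventuallyEq ?_
      filter_upwards [Ioi_mem_nhds (show 1 / 3 < t by linarith)] with s hs
      exact congrArg p (hηr s hs)
  refine (hsm.contMDiffOn (s := Icc 0 1)).congr fun t ht => ?_
  simp [ζ, Path.extend_apply _ ht]

variable [IsManifold (𝓡 d) ∞ M]

theorem OneForm.inChart_comp_mfderiv (θ : OneForm d M) (c : M) {y : M}
    (hy : y ∈ (chartAt (EuclideanSpace ℝ (Fin d)) c).source) :
    (θ.inChart c (chartAt (EuclideanSpace ℝ (Fin d)) c y)).comp
      (mfderiv (𝓡 d) (𝓡 d) (chartAt (EuclideanSpace ℝ (Fin d)) c) y) = θ y := by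
  have h1 := (mdifferentiable_chart (I := 𝓡 d) c).symm_comp_deriv hy
  -- The covectors at `z` and `y` have different types, so they are compared through their values on
  -- the model space.
  have h2 : ∀ z, z = y → ∀ v : EuclideanSpace ℝ (Fin d),
    (θ z : EuclideanSpace ℝ (Fin d) →L[ℝ] ℝ) v = (θ y : EuclideanSpace ℝ (Fin d) →L[ℝ] ℝ) v := by
    rintro z rfl v
    rfl
  ext v
  have h3 := congrArg (fun φ : EuclideanSpace ℝ (Fin d) →L[ℝ] EuclideanSpace ℝ (Fin d) => φ v) h1
  refine (h2 _ ((chartAt (EuclideanSpace ℝ (Fin d)) c).left_inv hy) _).trans ?_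
  exact congrArg (θ y) h3

theorem eventually_eq_of_hasMFDerivAt_zero {k : M → ℝ} {s : Set M} (hs : IsOpen s)
    (hk : ∀ y ∈ s, HasMFDerivAt (𝓡 d) 𝓘(ℝ, ℝ) k y 0) {x : M} (hx : x ∈ s) :
    ∀ᶠ y in 𝓝 x, k y = k x := by
  set e := chartAt (EuclideanSpace ℝ (Fin d)) x
  have hxe : x ∈ e.source := mem_chart_source _ x
  have hopen : IsOpen (e.target ∩ e.symm ⁻¹' s) := e.isOpen_inter_preimage_symm hs
  obtain ⟨r, hr, hball⟩ := Metric.isOpen_iff.1 hopen (e x)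
    ⟨e.map_source hxe, by simpa [e.left_inv hxe] using hx⟩
  have hder : ∀ y ∈ Metric.ball (e x) r, HasFDerivAt (k ∘ e.symm) (0 : _ →L[ℝ] ℝ) y := by
    intro y hy
    have h1 := (mdifferentiable_chart (I := 𝓡 d) x).mdifferentiableAt_symm (hball hy).1
    have h2 := (hk _ (hball hy).2).comp y h1.hasMFDerivAt
    rw [hasMFDerivAt_iff_hasFDerivAt] at h2
    rw [ContinuousLinearMap.zero_comp] at h2
    exact h2
  filter_upwards [e.open_source.mem_nhds hxe,
    (e.continuousAt hxe).preimage_mem_nhds (Metric.ball_mem_nhds _ hr)] with y hy hyr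
  have := Metric.isOpen_ball.is_const_of_fderiv_eq_zero (convex_ball (e x) r).isPreconnected
    (fun y hy => (hder y hy).differentiableAt.differentiableWithinAt)
    (fun y hy => (hder y hy).fderiv) hyr (Metric.mem_ball_self hr)
  simpa [e.left_inv hxe, e.left_inv hy] using this

/-- On an overlap two chart primitives have the same differential `θ`, so their difference is
locally constant. -/
theorem OneForm.IsSmoothClosed.exists_localPrimitives {θ : OneForm d M} (hθ : θ.IsSmoothClosed) :
    ∃ P : LocalPrimitives M ℝ, P.IsPrimitiveOf θ := by
  choose r hr ψ hball hψ hder using hθ.exists_primitive_inChart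
  let e := fun c : M => chartAt (EuclideanSpace ℝ (Fin d)) c
  let U : M → Set M := fun c => (e c).source ∩ e c ⁻¹' Metric.ball (e c c) (r c)
  have hU : ∀ c, IsOpen (U c) := fun c => (e c).isOpen_inter_preimage Metric.isOpen_ball
  have hmf : ∀ c, ∀ y ∈ U c, HasMFDerivAt (𝓡 d) 𝓘(ℝ, ℝ) (ψ c ∘ e c) y (θ y) := by
    intro c y hy
    have h1 := (mdifferentiable_chart (I := 𝓡 d) c).mdifferentiableAt hy.1
    have h2 := (hasMFDerivAt_iff_hasFDerivAt.2 (hder c _ hy.2)).comp y h1.hasMFDerivAt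
    have h3 := θ.inChart_comp_mfderiv c hy.1
    exact h3 ▸ h2
  refine ⟨⟨U, fun c => ψ c ∘ e c, hU,
    fun c => ⟨mem_chart_source _ c, Metric.mem_ball_self (hr c)⟩, ?_⟩, ?_, hmf⟩
  · intro i j x hx
    refine eventually_eq_of_hasMFDerivAt_zero (d := d) (k := fun y => (ψ i ∘ e i) y - (ψ j ∘ e j) y)
      ((hU i).inter (hU j)) (fun y hy => ?_) hx
    have := (hmf i y hy.1).sub (hmf j y hy.2)
    rwa [sub_self] at this
  · intro c
    have h1 : ContMDiffOn (𝓡 d) (𝓡 d) ∞ (e c) (e c).source := contMDiffOn_chart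
    exact (contMDiffOn_iff_contDiffOn.2 (hψ c)).comp (h1.mono inter_subset_left)
      inter_subset_right

/-- Straight segments in a chart of `M` composed with a local inverse of `p`. -/
theorem IsCoveringMap.eventually_smoothlyJoined {p : C(E, M)} (hp : IsCoveringMap p) (x : E) :
    ∀ᶠ y in 𝓝 x, SmoothlyJoined d p x y := by
  obtain ⟨e, hxe, he⟩ := hp.isLocalHomeomorph x
  set c := chartAt (EuclideanSpace ℝ (Fin d)) (p x)
  let φ := e.trans c
  have hx : x ∈ φ.source := by
    simp only [φ, OpenPartialHomeomorph.trans_source]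
    exact ⟨hxe, by rw [mem_preimage, ← he]; exact mem_chart_source _ _⟩
  obtain ⟨r, hr, hball⟩ := Metric.isOpen_iff.1 φ.open_target _ (φ.map_source hx)
  filter_upwards [φ.open_source.mem_nhds hx,
    (φ.continuousAt hx).preimage_mem_nhds (Metric.ball_mem_nhds _ hr)] with y hy hyr
  let l : ℝ → EuclideanSpace ℝ (Fin d) := fun t => AffineMap.lineMap (φ x) (φ y) t
  have hl : ∀ t ∈ Icc (0 : ℝ) 1, l t ∈ Metric.ball (φ x) r := fun t ht =>
    (convex_ball _ _).lineMap_mem (Metric.mem_ball_self hr) hyr ht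
  have hlc : Continuous l := AffineMap.lineMap_continuous
  let γ : Path x y :=
    ⟨⟨fun t => φ.symm (l t), φ.continuousOn_symm.comp_continuous (by fun_prop)
      fun t => hball (hl t t.2)⟩, by simp [l, φ.left_inv hx], by simp [l, φ.left_inv hy]⟩
  refine ⟨γ, ?_⟩
  have h1 : ContMDiffOn (𝓡 d) (𝓡 d) ∞ c.symm c.target := contMDiffOn_chart_symm
  have hcl : ∀ t ∈ Icc (0 : ℝ) 1, l t ∈ c.target ∧ c.symm (l t) ∈ e.target := fun t ht => by
    have := hball (hl t ht)
    rwa [OpenPartialHomeomorph.trans_target] at this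
  have hlsm : ContDiff ℝ ∞ l := by
    have : l = fun t => t • (φ y - φ x) + φ x := by
      ext1 t; simp [l, AffineMap.lineMap_apply]
    rw [this]
    fun_prop
  refine ((h1.comp (contMDiff_iff_contDiff.2 hlsm).contMDiffOn fun t ht => (hcl t ht).1).congr
    fun t ht => ?_ : ContMDiffOn 𝓘(ℝ, ℝ) (𝓡 d) ∞ (p ∘ γ.extend) (Icc 0 1))
  rw [Function.comp_apply, Path.extend_apply _ ht]
  change p (φ.symm (l t)) = c.symm (l t)
  rw [he]
  exact e.right_inv (hcl t ht).2

theorem IsCoveringMap.smoothlyJoined [PreconnectedSpace E] {p : C(E, M)} (hp : IsCoveringMap p)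
    (x y : E) : SmoothlyJoined d p x y := by
  have hclopen : IsClopen {z | SmoothlyJoined d p x z} := by
    constructor
    · rw [← isOpen_compl_iff, isOpen_iff_mem_nhds]
      intro z hz
      filter_upwards [hp.eventually_smoothlyJoined (d := d) z] with w hw hxw
      exact hz (hxw.trans hw.symm)
    · rw [isOpen_iff_mem_nhds]
      intro z hz
      filter_upwards [hp.eventually_smoothlyJoined (d := d) z] with w hw
      exact SmoothlyJoined.trans hz hw
  have := hclopen.eq_univ ⟨x, (hp.eventually_smoothlyJoined (d := d) x).self_of_nhds⟩
  have hy : y ∈ {z | SmoothlyJoined d p x z} := by rw [this]; exact mem_univ y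
  exact hy

/-- The Abel-Jacobi-Albanese map is given by primitives. -/
theorem abelJacobi_eq_sub [PreconnectedSpace E] {b : ℕ} {p : C(E, M)} (hp : IsCoveringMap p)
    {θ : Fin b → OneForm d M} {P : Fin b → LocalPrimitives M ℝ}
    (hP : ∀ i, (P i).IsPrimitiveOf (θ i)) {g : Fin b → E → ℝ}
    (hg : ∀ i, (P i).IsPrimitiveAlong p (g i)) (x₀ x : E) (i : Fin b) :
    abelJacobi p θ x₀ x i = g i x - g i x₀ := by
  -- Hence the default value in `abelJacobi` never occurs.
  have h : ∃ γ : Path x₀ x, IsSmoothCurve d (p ∘ γ.extend) := hp.smoothlyJoined x₀ x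
  rw [abelJacobi, dif_pos h]
  have h1 : (P i).IsPrimitiveAlong (fun t : unitInterval => (p ∘ h.choose.extend) t)
      (g i ∘ h.choose) := by
    have : (fun t : unitInterval => (p ∘ h.choose.extend) t) = p ∘ h.choose := by
      ext t; simp
    rw [this]
    exact (hg i).comp h.choose.continuous
  rw [(hP i).lineIntegral_eq h.choose_spec h1]
  simp

end Manifold

theorem IsLocalHomeomorph.locallyPathConnectedSpace {X Y : Type*} [TopologicalSpace X]
    [TopologicalSpace Y] [LocallyPathConnectedSpace Y] {p : X → Y} (hp : IsLocalHomeomorph p) :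
    LocallyPathConnectedSpace X := by
  choose e he _ using hp
  let _ : ChartedSpace Y X :=
    { atlas := range e
      chartAt := e
      mem_chart_source := he
      chart_mem_atlas := mem_range_self }
  exact ChartedSpace.locallyPathConnectedSpace Y X

/-! ### Lipschitz estimates for the Riemannian distance -/

theorem enorm_apply_le_of_enorm_lt {V W : Type*} [SeminormedAddCommGroup V]
    [SeminormedAddCommGroup W] [NormedSpace ℝ V] [NormedSpace ℝ W] {f : V →L[ℝ] W} {C : ℝ≥0}
    (h : ‖f‖ₑ < C) (v : V) : ‖f v‖ₑ ≤ C * ‖v‖ₑ :=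
  (f.le_opENorm v).trans (by gcongr)

section Riemannian

variable {d : ℕ} {M : Type u} [MetricSpace M]
  [ChartedSpace (EuclideanSpace ℝ (Fin d)) M] [IsManifold (𝓡 d) ∞ M]
  [RiemannianBundle (fun x : M => TangentSpace (𝓡 d) x)]

attribute [local instance] normedAddCommGroupTangentSpaceVectorSpace
attribute [local instance] normedSpaceTangentSpaceVectorSpace

theorem enorm_extChartAt_sub_le_pathELength {x : M} {C : ℝ≥0} {u : Set M}
    (hC : ∀ y ∈ u, ∀ v : TangentSpace (𝓡 d) y,
      ‖(mfderiv (𝓡 d) 𝓘(ℝ, EuclideanSpace ℝ (Fin d)) (extChartAt (𝓡 d) x) y v :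
        EuclideanSpace ℝ (Fin d))‖ₑ ≤ C * ‖v‖ₑ)
    (hu : u ⊆ (chartAt (EuclideanSpace ℝ (Fin d)) x).source) {γ : ℝ → M}
    (hγ : ContMDiffOn 𝓘(ℝ, ℝ) (𝓡 d) 1 γ (Icc 0 1)) (hγu : ∀ t ∈ Icc (0 : ℝ) 1, γ t ∈ u) :
    ‖extChartAt (𝓡 d) x (γ 1) - extChartAt (𝓡 d) x (γ 0)‖ₑ ≤ C * pathELength (𝓡 d) γ 0 1 := by
  have : IsManifold (𝓡 d) 1 M := .of_le (n := ∞) (by simp)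
  let γ' := extChartAt (𝓡 d) x ∘ γ
  have hC1 : ContMDiffOn 𝓘(ℝ, ℝ) 𝓘(ℝ, EuclideanSpace ℝ (Fin d)) 1 γ' (Icc 0 1) :=
    contMDiffOn_extChartAt.comp (t := (chartAt (EuclideanSpace ℝ (Fin d)) x).source)
      hγ (fun t ht => hu (hγu t ht))
  calc ‖γ' 1 - γ' 0‖ₑ
    _ ≤ ∫⁻ t in Icc 0 1, ‖derivWithin γ' (Icc 0 1) t‖ₑ := by
      apply enorm_sub_le_lintegral_derivWithin_Icc_of_contDiffOn_Icc _ zero_le_one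
      rwa [← contMDiffOn_iff_contDiffOn]
    _ = ∫⁻ t in Icc 0 1, ‖mfderivWithin 𝓘(ℝ, ℝ) 𝓘(ℝ, EuclideanSpace ℝ (Fin d)) γ'
        (Icc 0 1) t 1‖ₑ := by
      simp_rw [← fderivWithin_derivWithin, mfderivWithin_eq_fderivWithin]
      rfl
    _ ≤ ∫⁻ t in Icc 0 1, C * ‖mfderivWithin 𝓘(ℝ, ℝ) (𝓡 d) γ (Icc 0 1) t 1‖ₑ := by
      apply MeasureTheory.setLIntegral_mono' measurableSet_Icc (fun t ht ↦ ?_)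
      have h1 : mfderivWithin 𝓘(ℝ, ℝ) 𝓘(ℝ, EuclideanSpace ℝ (Fin d)) γ' (Icc 0 1) t =
          (mfderiv (𝓡 d) 𝓘(ℝ, EuclideanSpace ℝ (Fin d)) (extChartAt (𝓡 d) x) (γ t)) ∘L
            (mfderivWithin 𝓘(ℝ, ℝ) (𝓡 d) γ (Icc 0 1) t) := by
        apply mfderiv_comp_mfderivWithin
        · exact mdifferentiableAt_extChartAt (hu (hγu t ht))
        · exact (hγ t ht).mdifferentiableWithinAt one_ne_zero
        · rw [uniqueMDiffWithinAt_iff_uniqueDiffWithinAt]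
          exact uniqueDiffOn_Icc zero_lt_one _ ht
      have h2 : mfderivWithin 𝓘(ℝ, ℝ) 𝓘(ℝ, EuclideanSpace ℝ (Fin d)) γ' (Icc 0 1) t 1 =
          (mfderiv (𝓡 d) 𝓘(ℝ, EuclideanSpace ℝ (Fin d)) (extChartAt (𝓡 d) x) (γ t))
            (mfderivWithin 𝓘(ℝ, ℝ) (𝓡 d) γ (Icc 0 1) t 1) :=
        congr($h1 1)
      rw [h2]
      exact hC _ (hγu t ht) _
    _ = C * pathELength (𝓡 d) γ 0 1 := by
      rw [MeasureTheory.lintegral_const_mul' _ _ ENNReal.coe_ne_top,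
          pathELength_eq_lintegral_mfderivWithin_Icc]

variable [IsContMDiffRiemannianBundle (𝓡 d) ∞ (EuclideanSpace ℝ (Fin d))
    (fun x : M => TangentSpace (𝓡 d) x)]

theorem eventually_enorm_mfderiv_extChartAt_apply_le (x : M) : ∃ C : ℝ≥0, ∀ᶠ y in 𝓝 x,
    ∀ v : TangentSpace (𝓡 d) y, ‖(mfderiv (𝓡 d) 𝓘(ℝ, EuclideanSpace ℝ (Fin d))
      (extChartAt (𝓡 d) x) y v : EuclideanSpace ℝ (Fin d))‖ₑ ≤ C * ‖v‖ₑ := by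
  have : IsManifold (𝓡 d) 1 M := .of_le (n := ∞) (by simp)
  have : IsContinuousRiemannianBundle (EuclideanSpace ℝ (Fin d))
      (fun x : M => TangentSpace (𝓡 d) x) := by
    obtain ⟨g, hg, hg'⟩ := IsContMDiffRiemannianBundle.exists_contMDiff (IB := 𝓡 d) (n := ∞)
      (F := EuclideanSpace ℝ (Fin d)) (E := fun x : M => TangentSpace (𝓡 d) x)
    exact ⟨g, hg.continuous, hg'⟩
  obtain ⟨C, -, hC⟩ := eventually_enorm_mfderiv_extChartAt_lt (𝓡 d) x
  refine ⟨C, ?_⟩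
  filter_upwards [hC] with y hy
  intro v
  exact enorm_apply_le_of_enorm_lt hy v

variable [IsRiemannianManifold (𝓡 d) M]

/-- The charts are locally Lipschitz for the Riemannian distance. -/
theorem exists_lipschitzOnWith_extChartAt (x : M) :
    ∃ C : ℝ≥0, ∃ s ∈ 𝓝 x, LipschitzOnWith C (extChartAt (𝓡 d) x) s := by
  have : IsManifold (𝓡 d) 1 M := .of_le (n := ∞) (by simp)
  obtain ⟨C, hC⟩ := eventually_enorm_mfderiv_extChartAt_apply_le (d := d) x
  obtain ⟨r, hr, hball⟩ := Metric.mem_nhds_iff.1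
    (Filter.inter_mem hC (chart_source_mem_nhds (EuclideanSpace ℝ (Fin d)) x))
  -- A curve of length below `r / 2` starting in the ball of radius `r / 4` stays in the ball of
  -- radius `r`, where the derivative of the chart is bounded by `C`.
  refine ⟨C, Metric.ball x (r / 4), Metric.ball_mem_nhds _ (by positivity), fun y hy z hz => ?_⟩
  have hyz : edist y z < ENNReal.ofReal (r / 2) := by
    rw [edist_dist, ENNReal.ofReal_lt_ofReal_iff (by positivity)]
    have := dist_triangle_right y z x
    rw [Metric.mem_ball] at hy hz
    linarith
  -- The infimum of lengths need not be attained: the bound is shown for each `ρ` above the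
  -- distance, then `ρ` decreases to it.
  suffices H : ∀ ρ, edist y z < ρ → ρ < ENNReal.ofReal (r / 2) →
      edist (extChartAt (𝓡 d) x y) (extChartAt (𝓡 d) x z) ≤ C * ρ by
    have : (𝓝[>] edist y z).NeBot := nhdsGT_neBot_of_exists_gt ⟨_, hyz⟩
    refine ge_of_tendsto ((ENNReal.Tendsto.const_mul tendsto_id (Or.inr ENNReal.coe_ne_top)).mono_left
      (nhdsWithin_le_nhds (a := edist y z) (s := Ioi (edist y z)))) ?_
    filter_upwards [Ioo_mem_nhdsGT hyz] with ρ hρ using H ρ hρ.1 hρ.2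
  intro ρ hρ hρr
  rw [IsRiemannianManifold.out (I := 𝓡 d) y z] at hρ
  obtain ⟨γ, hγ0, hγ1, hγ, hlen⟩ := exists_lt_of_riemannianEDist_lt hρ
  have hmem : ∀ t ∈ Icc (0 : ℝ) 1, γ t ∈ Metric.ball x r := by
    intro t ht
    have h1 : edist y (γ t) < ENNReal.ofReal (r / 2) := by
      rw [IsRiemannianManifold.out (I := 𝓡 d) y (γ t)]
      refine ((riemannianEDist_le_pathELength (hγ.mono (Icc_subset_Icc_right ht.2)) hγ0 rfl
        ht.1).trans (pathELength_mono le_rfl ht.2)).trans_lt (hlen.trans hρr)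
    rw [edist_dist, ENNReal.ofReal_lt_ofReal_iff (by positivity)] at h1
    have := dist_triangle_left (γ t) x y
    rw [Metric.mem_ball] at hy ⊢
    linarith
  have := enorm_extChartAt_sub_le_pathELength (u := Metric.ball x r)
    (fun y hy => (hball hy).1) (fun y hy => (hball hy).2) hγ hmem
  rw [hγ0, hγ1] at this
  rw [edist_comm, edist_eq_enorm_sub]
  exact this.trans (by gcongr)

theorem ContMDiffAt.exists_lipschitzOnWith_dist {h : M → ℝ} {x : M}
    (hh : ContMDiffAt (𝓡 d) 𝓘(ℝ, ℝ) 1 h x) :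
    ∃ C : ℝ≥0, ∃ s ∈ 𝓝 x, LipschitzOnWith C h s := by
  obtain ⟨C, s, hs, hC⟩ := exists_lipschitzOnWith_extChartAt (d := d) x
  have h1 : ContDiffAt ℝ 1 (h ∘ (extChartAt (𝓡 d) x).symm) (extChartAt (𝓡 d) x x) := by
    have := (contMDiffAt_iff.1 hh).2
    rw [← contDiffWithinAt_univ]
    simpa only [modelWithCornersSelf_coe, range_id, extChartAt_self_eq, Function.comp_def,
      chartAt_self_eq, OpenPartialHomeomorph.refl_apply, id] using this
  obtain ⟨K, t, ht, hK⟩ := h1.exists_lipschitzOnWith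
  refine ⟨K * C, s ∩ (chartAt (EuclideanSpace ℝ (Fin d)) x).source ∩ extChartAt (𝓡 d) x ⁻¹' t,
    inter_mem (inter_mem hs (chart_source_mem_nhds _ _))
      ((continuousAt_extChartAt x).preimage_mem_nhds ht), fun y hy z hz => ?_⟩
  have h2 := hK.comp (hC.mono (fun y hy => hy.1.1)) (fun y hy => hy.2) hy hz
  simpa [(chartAt (EuclideanSpace ℝ (Fin d)) x).left_inv hy.1.2,
    (chartAt (EuclideanSpace ℝ (Fin d)) x).left_inv hz.1.2] using h2

theorem LocalPrimitives.IsPrimitiveOf.exists_lipschitzOnWith {P : LocalPrimitives M ℝ}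
    {θ : OneForm d M} (hP : P.IsPrimitiveOf θ) (m : M) :
    ∃ C : ℝ≥0, ∃ s ⊆ P.U m, IsOpen s ∧ m ∈ s ∧ LipschitzOnWith C (P.h m) s := by
  obtain ⟨C, s, hs, hC⟩ := ContMDiffAt.exists_lipschitzOnWith_dist
    (((hP.contMDiffOn m).contMDiffAt ((P.isOpen_U m).mem_nhds (P.mem_U m))).of_le
      (m := 1) (by simp))
  exact ⟨C, interior s ∩ P.U m, inter_subset_right, isOpen_interior.inter (P.isOpen_U m),
    ⟨mem_interior_iff_mem_nhds.2 hs, P.mem_U m⟩,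
    hC.mono (inter_subset_left.trans interior_subset)⟩

/-- Finitely many sets on which local primitives are Lipschitz cover `M`. A path is cut into pieces
projecting into these sets; on each piece `g` changes by at most `K` times the length, and lengths
add up. -/
theorem LocalPrimitives.IsPrimitiveOf.exists_edist_le_coverEDist [CompactSpace M] {E : Type v}
    [TopologicalSpace E] {p : C(E, M)} {P : LocalPrimitives M ℝ} {θ : OneForm d M}
    (hP : P.IsPrimitiveOf θ) {g : E → ℝ} (hg : P.IsPrimitiveAlong p g) :
    ∃ K : ℝ≥0, ∀ x y, edist (g x) (g y) ≤ K * coverEDist d p x y := by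
  choose C s hsU hso hms hC using hP.exists_lipschitzOnWith
  obtain ⟨T, hT⟩ := isCompact_univ.elim_finite_subcover s hso
    fun m _ => mem_iUnion.2 ⟨m, hms m⟩
  -- The summand `1` makes `K` nonzero, so that multiplication by `K` commutes with the infimum over
  -- paths.
  let K : ℝ≥0 := T.sup C + 1
  have hK : (K : ℝ≥0∞) ≠ 0 := by simp [K]
  refine ⟨K, fun x y => ?_⟩
  rw [coverEDist, ENNReal.mul_iInf_of_ne hK ENNReal.coe_ne_top]
  refine le_iInf fun γ => ?_
  rw [ENNReal.mul_iInf_of_ne hK ENNReal.coe_ne_top]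
  refine le_iInf fun hγ => ?_
  set c := p ∘ γ.extend
  have hcγ : ∀ t : unitInterval, c t = p (γ t) := fun t => by simp [c]
  have hγg : P.IsPrimitiveAlong (p ∘ γ) (g ∘ γ) := hg.comp γ.continuous
  obtain ⟨t, ht0, htm, ⟨n, hn⟩, htc⟩ := exists_monotone_Icc_subset_open_cover_unitInterval
    (c := fun m : T => (p ∘ γ) ⁻¹' s m)
    (fun m => (hso m).preimage (p.continuous.comp γ.continuous)) fun t _ => by
      obtain ⟨m, hm, hmt⟩ := mem_iUnion₂.1 (hT (mem_univ (p (γ t))))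
      exact mem_iUnion.2 ⟨⟨m, hm⟩, hmt⟩
  have hstep : ∀ k, edist (g (γ (t k))) (g (γ (t (k + 1)))) ≤
      K * pathELength (𝓡 d) c (t k) (t (k + 1)) := by
    intro k
    obtain ⟨⟨m, hmT⟩, hm⟩ := htc k
    have hle : t k ≤ t (k + 1) := htm k.le_succ
    have : PreconnectedSpace (Icc (t k) (t (k + 1))) :=
      Subtype.preconnectedSpace isPreconnected_Icc
    have h1 : P.IsPrimitiveAlong (fun r : Icc (t k) (t (k + 1)) => p (γ r)) (fun r => g (γ r)) :=
      hγg.comp continuous_subtype_val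
    have h2 := h1.sub_eq_sub (LocalPrimitives.IsPrimitiveAlong.of_mapsTo m
      (fun r => hsU m (hm r.2)) (by fun_prop)) ⟨t k, left_mem_Icc.2 hle⟩
      ⟨t (k + 1), right_mem_Icc.2 hle⟩
    rw [edist_eq_enorm_sub, h2, ← edist_eq_enorm_sub]
    refine (hC m (hm (left_mem_Icc.2 hle)) (hm (right_mem_Icc.2 hle))).trans ?_
    refine mul_le_mul' (ENNReal.coe_le_coe.2 ((Finset.le_sup hmT).trans (by simp [K]))) ?_
    rw [IsRiemannianManifold.out (I := 𝓡 d)]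
    exact riemannianEDist_le_pathELength
      (hγ.mono (Icc_subset_Icc (t k).2.1 (t (k + 1)).2.2)) (hcγ _) (hcγ _) hle
  have hind : ∀ k, edist (g (γ 0)) (g (γ (t k))) ≤ K * pathELength (𝓡 d) c 0 (t k) := by
    intro k
    induction k with
    | zero => simp [ht0]
    | succ k ih =>
      rw [← pathELength_add (t k).2.1 (htm k.le_succ : t k ≤ t (k + 1)), mul_add]
      exact (edist_triangle _ _ _).trans (add_le_add ih (hstep k))
  have := hind n
  rw [hn n le_rfl] at this
  simpa using this

end Riemannian

theorem edist_le_coverEDist {d : ℕ} {M : Type u} [MetricSpace M]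
    [ChartedSpace (EuclideanSpace ℝ (Fin d)) M]
    [RiemannianBundle (fun x : M => TangentSpace (𝓡 d) x)] [IsRiemannianManifold (𝓡 d) M]
    {E : Type v} [TopologicalSpace E] (p : C(E, M)) (x y : E) :
    edist (p x) (p y) ≤ coverEDist d p x y := by
  refine le_iInf₂ fun γ hγ => ?_
  rw [IsRiemannianManifold.out (I := 𝓡 d)]
  exact riemannianEDist_le_pathELength hγ (by simp) (by simp) zero_le_one

/-! ### Powers of the inverse of an expanding matrix -/

section ExpandingMatrix

variable {b : ℕ}

theorem realMatrix_map_ofReal (A : Matrix (Fin b) (Fin b) ℤ) :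
    (realMatrix A).map Complex.ofReal = complexMatrix A := by
  ext i j
  simp

theorem IsExpandingMatrix.isUnit_complexMatrix {A : Matrix (Fin b) (Fin b) ℤ}
    (hA : IsExpandingMatrix A) : IsUnit (complexMatrix A) := by
  by_contra h
  have := hA 0 (spectrum.zero_mem ℂ h)
  simp at this
  linarith

theorem IsExpandingMatrix.isUnit_det_realMatrix {A : Matrix (Fin b) (Fin b) ℤ}
    (hA : IsExpandingMatrix A) : IsUnit (realMatrix A).det := by
  have h1 := (Matrix.isUnit_iff_isUnit_det _).1 hA.isUnit_complexMatrix
  rw [← realMatrix_map_ofReal] at h1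
  have h2 : ((realMatrix A).map Complex.ofReal).det = ((realMatrix A).det : ℂ) :=
    (RingHom.map_det Complex.ofRealHom (realMatrix A)).symm
  rw [h2, isUnit_iff_ne_zero] at h1
  exact isUnit_iff_ne_zero.2 (by exact_mod_cast h1)

theorem IsExpandingMatrix.complexMatrix_inv_pow {A : Matrix (Fin b) (Fin b) ℤ}
    (hA : IsExpandingMatrix A) (n : ℕ) :
    (complexMatrix A)⁻¹ ^ n = ((realMatrix A)⁻¹ ^ n).map Complex.ofReal := by
  have h1 : (complexMatrix A)⁻¹ = (realMatrix A)⁻¹.map Complex.ofReal := by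
    refine Matrix.inv_eq_right_inv ?_
    rw [← realMatrix_map_ofReal]
    have := congrArg (Complex.ofRealHom.mapMatrix)
      (Matrix.mul_nonsing_inv _ hA.isUnit_det_realMatrix)
    rwa [map_mul, map_one] at this
  rw [h1]
  exact (map_pow Complex.ofRealHom.mapMatrix _ n).symm

attribute [local instance] Matrix.linftyOpNormedRing Matrix.linftyOpNormedAlgebra

/-- The spectral radius is attained at some `k`, and `k⁻¹` is an eigenvalue of `A`. The spectrum is
empty only when `b = 0`. -/
theorem IsExpandingMatrix.spectralRadius_inv_lt_one {A : Matrix (Fin b) (Fin b) ℤ}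
    (hA : IsExpandingMatrix A) : spectralRadius ℂ (complexMatrix A)⁻¹ < 1 := by
  have : ProperSpace ℂ := inferInstance
  have : CompleteSpace (Matrix (Fin b) (Fin b) ℂ) := FiniteDimensional.complete ℂ _
  rcases (spectrum ℂ (complexMatrix A)⁻¹).eq_empty_or_nonempty with h | h
  · simp [spectralRadius, h]
  · obtain ⟨k, hk, hkr⟩ := spectrum.exists_nnnorm_eq_spectralRadius_of_nonempty h
    rw [← hkr]
    obtain ⟨a, ha⟩ := hA.isUnit_complexMatrix
    have hinv : (complexMatrix A)⁻¹ = (a⁻¹ : (Matrix (Fin b) (Fin b) ℂ)ˣ) := by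
      rw [← ha, Matrix.coe_units_inv]
    rw [hinv] at hk
    have hk0 : k ≠ 0 := by
      rintro rfl
      exact spectrum.zero_notMem ℂ (a⁻¹).isUnit hk
    have h1 : ((Units.mk0 k hk0)⁻¹ : ℂˣ).1 ∈ spectrum ℂ (a : Matrix (Fin b) (Fin b) ℂ) := by
      have := (spectrum.inv_mem_iff (r := Units.mk0 k hk0) (a := a⁻¹)).1 hk
      rwa [inv_inv] at this
    rw [ha] at h1
    have h2 := hA _ h1
    rw [Units.val_inv_eq_inv_val, Units.val_mk0, norm_inv] at h2
    have h3 : ‖k‖ < 1 := by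
      by_contra h4
      exact absurd h2 (not_lt.2 (inv_le_one_of_one_le₀ (not_lt.1 h4)))
    exact_mod_cast h3

/-- Gelfand's formula gives `‖B ^ n‖ ≤ q ^ n` for large `n`, and `C` absorbs the other `n`. The
formula is applied over `ℂ`; real vectors keep their sup norm there. -/
theorem IsExpandingMatrix.exists_norm_inv_pow_mulVec_le {A : Matrix (Fin b) (Fin b) ℤ}
    (hA : IsExpandingMatrix A) {q : ℝ} (hq0 : 0 < q)
    (hq : spectralRadius ℂ (complexMatrix A)⁻¹ < ENNReal.ofReal q) :
    ∃ C, 0 ≤ C ∧ ∀ (n : ℕ) (v : Fin b → ℝ), ‖(realMatrix A)⁻¹ ^ n *ᵥ v‖ ≤ C * q ^ n * ‖v‖ := by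
  have : CompleteSpace (Matrix (Fin b) (Fin b) ℂ) := FiniteDimensional.complete ℂ _
  set B := (complexMatrix A)⁻¹
  have h1 : ∀ᶠ n : ℕ in atTop, ‖B ^ n‖ / q ^ n ≤ 1 := by
    filter_upwards [(spectrum.pow_nnnorm_pow_one_div_tendsto_nhds_spectralRadius B).eventually
      (gt_mem_nhds hq), eventually_ge_atTop 1] with n hn hn1
    have hn0 : (n : ℝ) ≠ 0 := by positivity
    have h2 : (‖B ^ n‖₊ : ℝ≥0∞) ≤ ENNReal.ofReal q ^ n := by
      calc (‖B ^ n‖₊ : ℝ≥0∞) = ((‖B ^ n‖₊ : ℝ≥0∞) ^ (1 / n : ℝ)) ^ n := by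
            rw [← ENNReal.rpow_natCast, ← ENNReal.rpow_mul, one_div_mul_cancel hn0,
              ENNReal.rpow_one]
        _ ≤ _ := pow_le_pow_left' hn.le n
    rw [div_le_one (by positivity)]
    rw [← ENNReal.ofReal_pow hq0.le, ← enorm_eq_nnnorm, ← ofReal_norm,
      ENNReal.ofReal_le_ofReal_iff (by positivity)] at h2
    exact h2
  obtain ⟨C, hC⟩ := Filter.IsBoundedUnder.bddAbove_range ⟨1, eventually_map.2 h1⟩
  refine ⟨max C 0, le_max_right _ _, fun n v => ?_⟩
  have h2 : ‖B ^ n‖ ≤ max C 0 * q ^ n := by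
    rw [← div_le_iff₀ (by positivity)]
    exact (hC (mem_range_self n)).trans (le_max_left _ _)
  have hnorm : ∀ w : Fin b → ℝ, ‖fun i => (w i : ℂ)‖ = ‖w‖ := fun w => by
    simp [Pi.norm_def]
  have h3 : (B ^ n) *ᵥ (fun i => (v i : ℂ)) =
      fun i => (((realMatrix A)⁻¹ ^ n *ᵥ v) i : ℂ) := by
    rw [hA.complexMatrix_inv_pow]
    ext i
    simp [Matrix.mulVec, dotProduct]
  rw [← hnorm, ← h3, ← hnorm v]
  exact (Matrix.linfty_opNorm_mulVec _ _).trans (by gcongr)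

end ExpandingMatrix

/-- The lower bound comes from the positive minimum of `N` on the unit sphere, which is empty when
`b = 0`. -/
theorem Seminorm.exists_norm_bounds {b : ℕ} (N : Seminorm ℝ (Fin b → ℝ))
    (hN : ∀ v, N v = 0 → v = 0) :
    ∃ c c' : ℝ, 0 ≤ c ∧ 0 ≤ c' ∧ (∀ v, N v ≤ c * ‖v‖) ∧ ∀ v, ‖v‖ ≤ c' * N v := by
  have h1 : ∀ v, N v ≤ (∑ i, N (Pi.single i 1)) * ‖v‖ := by
    intro v
    have hv : v = ∑ i, v i • Pi.single i (1 : ℝ) := by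
      ext j
      simp [Finset.sum_apply, Pi.single_apply]
    calc N v = N (∑ i, v i • Pi.single i (1 : ℝ)) := by rw [← hv]
      _ ≤ ∑ i, N (v i • Pi.single i (1 : ℝ)) :=
        Finset.le_sum_of_subadditive N (map_zero N).le (map_add_le_add N) _ _
      _ ≤ ∑ i, N (Pi.single i 1) * ‖v‖ := by
        refine Finset.sum_le_sum fun i _ => ?_
        rw [map_smul_eq_mul, mul_comm]
        exact mul_le_mul_of_nonneg_left (norm_le_pi_norm v i) (apply_nonneg _ _)
      _ = _ := by rw [Finset.sum_mul]
  have hc : 0 ≤ ∑ i, N (Pi.single i (1 : ℝ)) := Finset.sum_nonneg fun i _ => apply_nonneg _ _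
  have hcont : Continuous N := (LipschitzWith.of_dist_le_mul (K := ⟨_, hc⟩) fun v w => by
    rw [Real.dist_eq, dist_eq_norm]
    exact (abs_sub_map_le_sub N v w).trans (h1 _)).continuous
  rcases subsingleton_or_nontrivial (Fin b → ℝ) with hs | hs
  · refine ⟨_, 0, hc, le_rfl, h1, fun v => ?_⟩
    simp [Subsingleton.elim v 0]
  obtain ⟨v₀, hv₀, hmin⟩ := (isCompact_sphere (0 : Fin b → ℝ) 1).exists_isMinOn
    (NormedSpace.sphere_nonempty.2 zero_le_one) hcont.continuousOn
  have hpos : 0 < N v₀ := by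
    refine lt_of_le_of_ne (apply_nonneg _ _) fun h => ?_
    have := hN v₀ h.symm
    simp [this] at hv₀
  refine ⟨_, (N v₀)⁻¹, hc, (inv_pos.2 hpos).le, h1, fun v => ?_⟩
  rcases eq_or_ne v 0 with rfl | hv
  · simp
  have hv' : 0 < ‖v‖ := norm_pos_iff.2 hv
  have h2 : N v₀ ≤ N (‖v‖⁻¹ • v) := hmin (by simp [norm_smul, hv'.ne'])
  rw [map_smul_eq_mul, norm_inv, norm_norm, ← div_eq_inv_mul, le_div_iff₀ hv'] at h2
  rw [← div_eq_inv_mul, le_div_iff₀ hpos, mul_comm]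
  exact h2

/-! ### The correction series -/

section Series

variable {b : ℕ} {X : Type*} [TopologicalSpace X] [CompactSpace X]

/-- The series `∑ Bⁿ⁺¹ σ(fⁿ x)`. -/
def correctionSeries (B : Matrix (Fin b) (Fin b) ℝ) (f : C(X, X)) (σ : C(X, Fin b → ℝ)) (x : X) :
    Fin b → ℝ :=
  ∑' n : ℕ, B ^ (n + 1) *ᵥ σ (f^[n] x)

variable {B : Matrix (Fin b) (Fin b) ℝ} (f : C(X, X)) (σ : C(X, Fin b → ℝ)) {C q : ℝ}

theorem norm_correctionSeries_term_le (hC : 0 ≤ C) (hq : 0 ≤ q)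
    (hB : ∀ (n : ℕ) (v : Fin b → ℝ), ‖B ^ n *ᵥ v‖ ≤ C * q ^ n * ‖v‖) (n : ℕ) (x : X) :
    ‖B ^ (n + 1) *ᵥ σ (f^[n] x)‖ ≤ C * q ^ (n + 1) * ‖σ‖ :=
  (hB _ _).trans (by gcongr; exact σ.norm_coe_le_norm _)

theorem summable_correctionSeries_bound (hq : 0 ≤ q) (hq1 : q < 1) (D : ℝ) :
    Summable fun n : ℕ => C * q ^ (n + 1) * D :=
  (((summable_nat_add_iff 1).2 (summable_geometric_of_lt_one hq hq1)).mul_left C).mul_right D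

theorem hasSum_correctionSeries (hC : 0 ≤ C) (hq : 0 ≤ q) (hq1 : q < 1)
    (hB : ∀ (n : ℕ) (v : Fin b → ℝ), ‖B ^ n *ᵥ v‖ ≤ C * q ^ n * ‖v‖) (x : X) :
    HasSum (fun n : ℕ => B ^ (n + 1) *ᵥ σ (f^[n] x)) (correctionSeries B f σ x) :=
  (Summable.of_norm_bounded (summable_correctionSeries_bound hq hq1 _)
    fun n => norm_correctionSeries_term_le f σ hC hq hB n x).hasSum

theorem continuous_correctionSeries (hC : 0 ≤ C) (hq : 0 ≤ q) (hq1 : q < 1)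
    (hB : ∀ (n : ℕ) (v : Fin b → ℝ), ‖B ^ n *ᵥ v‖ ≤ C * q ^ n * ‖v‖) :
    Continuous (correctionSeries B f σ) := by
  refine continuous_tsum (fun n => ?_) (summable_correctionSeries_bound hq hq1 ‖σ‖)
    fun n x => norm_correctionSeries_term_le f σ hC hq hB n x
  exact Continuous.matrix_mulVec continuous_const (σ.continuous.comp (f.continuous.iterate n))

theorem exists_norm_correctionSeries_le (hC : 0 ≤ C) (hq : 0 ≤ q) (hq1 : q < 1)
    (hB : ∀ (n : ℕ) (v : Fin b → ℝ), ‖B ^ n *ᵥ v‖ ≤ C * q ^ n * ‖v‖) :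
    ∃ D, ∀ x, ‖correctionSeries B f σ x‖ ≤ D :=
  ⟨_, fun x => tsum_of_norm_bounded (summable_correctionSeries_bound hq hq1 _).hasSum
    fun n => norm_correctionSeries_term_le f σ hC hq hB n x⟩

end Series

/-- On a space of diameter `Δ`, a `K`-Lipschitz map is `ν`-Hölder with constant `K Δ ^ (1 - ν)`. As
`fⁿ` is `Lⁿ`-Lipschitz, the terms are dominated by a geometric series of ratio `q L ^ ν`. -/
theorem exists_norm_correctionSeries_sub_le {b : ℕ} {X : Type*} [MetricSpace X] [CompactSpace X]
    {B : Matrix (Fin b) (Fin b) ℝ} {f : C(X, X)} {σ : C(X, Fin b → ℝ)} {C q : ℝ}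
    (hC : 0 ≤ C) (hq : 0 ≤ q) (hq1 : q < 1)
    (hB : ∀ (n : ℕ) (v : Fin b → ℝ), ‖B ^ n *ᵥ v‖ ≤ C * q ^ n * ‖v‖) {K L : ℝ≥0}
    (hσ : LipschitzWith K σ) (hf : LipschitzWith L f) {ν : ℝ} (hν0 : 0 < ν) (hν1 : ν ≤ 1)
    (hν : q * (L : ℝ) ^ ν < 1) :
    ∃ D, 0 ≤ D ∧ ∀ x y, ‖correctionSeries B f σ x - correctionSeries B f σ y‖ ≤
      D * dist x y ^ ν := by
  set Δ := Metric.diam (univ : Set X)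
  have hΔ : 0 ≤ Δ := Metric.diam_nonneg
  have hhol : ∀ x y, ‖σ x - σ y‖ ≤ K * Δ ^ (1 - ν) * dist x y ^ ν := by
    intro x y
    rw [← dist_eq_norm]
    refine (hσ.dist_le_mul x y).trans ?_
    rw [mul_assoc]
    gcongr
    have hd : dist x y ≤ Δ :=
      Metric.dist_le_diam_of_mem isCompact_univ.isBounded (mem_univ _) (mem_univ _)
    calc dist x y = dist x y ^ ((1 - ν) + ν) := by simp
      _ = dist x y ^ (1 - ν) * dist x y ^ ν :=
        Real.rpow_add_of_nonneg dist_nonneg (by linarith) hν0.le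
      _ ≤ _ := by gcongr
  have hterm : ∀ (n : ℕ) (x y : X),
      ‖B ^ (n + 1) *ᵥ σ (f^[n] x) - B ^ (n + 1) *ᵥ σ (f^[n] y)‖ ≤
        (C * q * (K * Δ ^ (1 - ν)) * dist x y ^ ν) * (q * (L : ℝ) ^ ν) ^ n := by
    intro n x y
    rw [← Matrix.mulVec_sub]
    have h1 : dist (f^[n] x) (f^[n] y) ≤ (L : ℝ) ^ n * dist x y := by
      simpa using (hf.iterate n).dist_le_mul x y
    calc ‖B ^ (n + 1) *ᵥ (σ (f^[n] x) - σ (f^[n] y))‖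
        ≤ C * q ^ (n + 1) * ‖σ (f^[n] x) - σ (f^[n] y)‖ := hB _ _
      _ ≤ C * q ^ (n + 1) * (K * Δ ^ (1 - ν) * ((L : ℝ) ^ n * dist x y) ^ ν) := by
        gcongr
        exact (hhol _ _).trans (by gcongr)
      _ = _ := by
        rw [Real.mul_rpow (by positivity) dist_nonneg, ← Real.rpow_pow_comm L.coe_nonneg]
        ring
  have hr0 : 0 ≤ q * (L : ℝ) ^ ν := by positivity
  refine ⟨C * q * (K * Δ ^ (1 - ν)) * (1 - q * (L : ℝ) ^ ν)⁻¹, ?_, fun x y => ?_⟩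
  · have : 0 ≤ (1 - q * (L : ℝ) ^ ν)⁻¹ := inv_nonneg.2 (by linarith)
    positivity
  · have h1 := (hasSum_correctionSeries f σ hC hq hq1 hB x).sub
      (hasSum_correctionSeries f σ hC hq hq1 hB y)
    rw [← h1.tsum_eq]
    refine (tsum_of_norm_bounded ((hasSum_geometric_of_lt_one hr0 hν).mul_left _)
      fun n => hterm n x y).trans (le_of_eq ?_)
    ring

/-! ### Periods -/

section Periods

variable {d b : ℕ} {M : Type u} [TopologicalSpace M] [ChartedSpace (EuclideanSpace ℝ (Fin d)) M]
  {Γ : Module.Basis (Fin b) ℤ (H1 M)} {θ : Fin b → OneForm d M} {P : Fin b → LocalPrimitives M ℝ}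

/-- A period is given through one smooth loop; this frees it from the choice of loop. -/
theorem OneForm.HasPeriod.homologyIntegral_eq {P : LocalPrimitives M ℝ} {θ : OneForm d M}
    (hP : P.IsPrimitiveOf θ) {h : H1 M} {r : ℝ} (hr : θ.HasPeriod h r) :
    (P.homologyIntegral h).down = r := by
  obtain ⟨x, γ, hγ, rfl, rfl⟩ := hr
  rw [P.homologyIntegral_loopClass]
  obtain ⟨g, hg⟩ := P.exists_isPrimitiveAlong γ.toContinuousMap
  have h1 : P.IsPrimitiveAlong γ g := hg
  have h2 : P.IsPrimitiveAlong (fun t : unitInterval => γ.extend t) g := by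
    have : (fun t : unitInterval => γ.extend t) = γ := by ext t; simp
    rwa [this]
  rw [h1.pathIntegral_eq, hP.lineIntegral_eq hγ h2]

theorem sum_zsmul_repr (Γ : Module.Basis (Fin b) ℤ (H1 M)) (h : H1 M) :
    ∑ i, Γ.repr h i • Γ i = h :=
  (Finset.sum_congr rfl fun i _ => (int_smul_eq_zsmul _ (Γ.repr h i) (Γ i)).symm).trans
    (Γ.sum_repr h)

theorem repr_sum_zsmul (Γ : Module.Basis (Fin b) ℤ (H1 M)) (n : Fin b → ℤ) (i : Fin b) :
    Γ.repr (∑ j, n j • Γ j) i = n i := by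
  have h : ∑ j, n j • Γ j = Γ.equivFun.symm n := by
    rw [Γ.equivFun_symm_apply]
    exact Finset.sum_congr rfl fun j _ => (int_smul_eq_zsmul _ (n j) (Γ j)).symm
  rw [h, ← Γ.equivFun_apply, LinearEquiv.apply_symm_apply]

/-- The integrals of the dual forms are the coordinates of the homology class. -/
theorem pathIntegral_eq_repr (hP : ∀ i, (P i).IsPrimitiveOf (θ i))
    (hdual : ∀ i j, (θ i).HasPeriod (Γ j) (if i = j then 1 else 0)) {x : M} (γ : Path x x)
    (i : Fin b) : (P i).pathIntegral γ = (Γ.repr (loopClass γ) i : ℝ) := by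
  rw [← (P i).homologyIntegral_loopClass]
  conv_lhs => rw [← sum_zsmul_repr Γ (loopClass γ)]
  have h1 : ∀ j, ((P i).homologyIntegral (Γ j)).down = if i = j then 1 else 0 :=
    fun j => (hdual i j).homologyIntegral_eq (hP i)
  have h2 : ∀ s : Finset (Fin b), ∀ c : Fin b → ℤ,
      ((P i).homologyIntegral (∑ j ∈ s, c j • Γ j)).down =
        ∑ j ∈ s, (c j : ℝ) * ((P i).homologyIntegral (Γ j)).down := by
    intro s c
    induction s using Finset.induction_on with
    | empty => simp
    | insert a s ha ih =>
      rw [Finset.sum_insert ha, Finset.sum_insert ha, map_add, map_zsmul, ULift.add_down, ih,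
        ULift.smul_down, zsmul_eq_mul]
  rw [h2]
  simp [h1]

variable {E : Type v} [TopologicalSpace E] {p : C(E, M)} {g : Fin b → E → ℝ}

theorem sub_eq_of_loopClass_eq (hP : ∀ i, (P i).IsPrimitiveOf (θ i))
    (hdual : ∀ i j, (θ i).HasPeriod (Γ j) (if i = j then 1 else 0))
    (hg : ∀ i, (P i).IsPrimitiveAlong p (g i)) {x y : E} (h : p y = p x) (γ : Path x y)
    {n : Fin b → ℤ}
    (hn : loopClass ((γ.map p.continuous).cast rfl h.symm) = ∑ i, n i • Γ i) (i : Fin b) :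
    g i y - g i x = n i := by
  have h1 := pathIntegral_eq_repr hP hdual ((γ.map p.continuous).cast rfl h.symm) i
  rw [LocalPrimitives.pathIntegral_cast, (hg i).pathIntegral_map, hn] at h1
  rw [h1, repr_sum_zsmul]

/-- A path from `x` to `y` projects to a loop `η` with coordinates `n`; its image under `F` projects
to `f ∘ η`, whose class is the image of that of `η` under `f_*`. -/
theorem exists_int_of_map_eq [PathConnectedSpace E] (hP : ∀ i, (P i).IsPrimitiveOf (θ i))
    (hdual : ∀ i j, (θ i).HasPeriod (Γ j) (if i = j then 1 else 0))
    (hg : ∀ i, (P i).IsPrimitiveAlong p (g i)) {f : C(M, M)} {F : C(E, E)}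
    (hF : ∀ x, p (F x) = f (p x)) {x y : E} (h : p y = p x) :
    ∃ n : Fin b → ℤ, (∀ i, g i y - g i x = n i) ∧
      ∀ i, g i (F y) - g i (F x) = (realMatrix (homologyMatrix Γ f) *ᵥ fun j => (n j : ℝ)) i := by
  let γ := PathConnectedSpace.somePath x y
  let η : Path (p x) (p x) := (γ.map p.continuous).cast rfl h.symm
  have h' : p (F y) = p (F x) := by rw [hF, hF, h]
  have hη : loopClass η = ∑ i, Γ.repr (loopClass η) i • Γ i := (sum_zsmul_repr Γ _).symm
  refine ⟨fun i => Γ.repr (loopClass η) i,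
    sub_eq_of_loopClass_eq hP hdual hg h γ hη, fun i => ?_⟩
  have h2 : (P i).pathIntegral (η.map f.continuous) = g i (F y) - g i (F x) := by
    rw [← (hg i).pathIntegral_map (γ.map F.continuous)]
    have : (η.map f.continuous) =
        ((γ.map F.continuous).map p.continuous).cast (hF x).symm (by rw [hF, h]) := by
      ext t
      exact (hF _).symm
    rw [this, LocalPrimitives.pathIntegral_cast]
  rw [← h2, pathIntegral_eq_repr hP hdual, ← H1map_loopClass,
    ← LinearMap.toMatrix_mulVec_repr Γ Γ (H1map f)]
  simp [Matrix.mulVec, dotProduct, homologyMatrix]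

end Periods

/-! ### Regularity of the displacement -/

section Displacement

variable {d : ℕ} {M : Type u} [MetricSpace M]
  [ChartedSpace (EuclideanSpace ℝ (Fin d)) M] [IsManifold (𝓡 d) ∞ M]
  [RiemannianBundle (fun x : M => TangentSpace (𝓡 d) x)]
  [IsContMDiffRiemannianBundle (𝓡 d) ∞ (EuclideanSpace ℝ (Fin d))
    (fun x : M => TangentSpace (𝓡 d) x)]
  [IsRiemannianManifold (𝓡 d) M] {E : Type v} [TopologicalSpace E]

/-- Used with `k = id` and `k = f` for the two parts of the displacement. Both points vary, as a
Lipschitz bound near `p x` requires. -/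
theorem LocalPrimitives.IsPrimitiveOf.eventually_abs_sub_le {P : LocalPrimitives M ℝ}
    {θ : OneForm d M} (hP : P.IsPrimitiveOf θ) {p : C(E, M)} {k : C(M, M)} {L : ℝ≥0}
    (hk : LipschitzWith L k) {g : E → ℝ} (hg : P.IsPrimitiveAlong (k ∘ p) g) (x : E) :
    ∃ K : ℝ, ∀ᶠ y in 𝓝 x ×ˢ 𝓝 x, |g y.1 - g y.2| ≤ K * dist (p y.1) (p y.2) := by
  obtain ⟨C, s, -, hso, hms, hC⟩ := hP.exists_lipschitzOnWith (k (p x))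
  have h1 : ∀ᶠ y in 𝓝 x, k (p y) ∈ s ∧
      g y - g x = P.h (k (p x)) (k (p y)) - P.h (k (p x)) (k (p x)) :=
    (((k.continuous.comp p.continuous).continuousAt (x := x)).eventually
      (hso.mem_nhds hms)).and (hg x (k (p x)) (P.mem_U _))
  refine ⟨C * L, ?_⟩
  filter_upwards [h1.prod_mk h1] with y hy
  obtain ⟨⟨hy1, hy1'⟩, hy2, hy2'⟩ := hy
  have h2 : g y.1 - g y.2 = P.h (k (p x)) (k (p y.1)) - P.h (k (p x)) (k (p y.2)) := by
    linarith
  rw [h2, ← Real.dist_eq]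
  refine (hC.dist_le_mul _ hy1 _ hy2).trans ?_
  rw [mul_assoc]
  gcongr
  exact hk.dist_le_mul _ _

variable [CompactSpace M]

/-- Since `g ∘ F` is a primitive along `f ∘ p`, each part is locally Lipschitz in terms of distances
in `M`. The open map `p` carries this down to `M`, and compactness makes it global. -/
theorem exists_lipschitzWith_displacement {b : ℕ} {θ : Fin b → OneForm d M}
    {P : Fin b → LocalPrimitives M ℝ} (hP : ∀ i, (P i).IsPrimitiveOf (θ i)) {p : C(E, M)}
    (hp : IsOpenMap p) (hps : Function.Surjective p) {f : C(M, M)} {F : C(E, E)}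
    (hF : ∀ x, p (F x) = f (p x)) {L : ℝ≥0} (hf : LipschitzWith L f) {g : Fin b → E → ℝ}
    (hg : ∀ i, (P i).IsPrimitiveAlong p (g i)) {A : Matrix (Fin b) (Fin b) ℝ} {a : Fin b → ℝ}
    {σ : M → Fin b → ℝ} (hσ : ∀ x i, σ (p x) i = g i (F x) - ∑ j, A i j * g j x + a i) :
    ∃ K : ℝ≥0, LipschitzWith K σ := by
  have hcomp : ∀ i, ∃ K : ℝ≥0, LipschitzWith K fun m => σ m i := by
    intro i
    have hloc : LocallyLipschitz fun m => σ m i := by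
      intro m
      obtain ⟨x, rfl⟩ := hps m
      have h1 : (P i).IsPrimitiveAlong (f ∘ p) (g i ∘ F) := by
        have : f ∘ p = p ∘ F := by ext y; exact (hF y).symm
        rw [this]
        exact (hg i).comp F.continuous
      obtain ⟨K', hK'⟩ := (hP i).eventually_abs_sub_le hf h1 x
      have h2 : ∀ j, ∃ K : ℝ, ∀ᶠ y in 𝓝 x ×ˢ 𝓝 x,
          |g j y.1 - g j y.2| ≤ K * dist (p y.1) (p y.2) := fun j =>
        (hP j).eventually_abs_sub_le (k := ContinuousMap.id M) LipschitzWith.id (hg j) x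
      choose K hK using h2
      have h3 : ∀ᶠ y in 𝓝 x ×ˢ 𝓝 x, |σ (p y.1) i - σ (p y.2) i| ≤
          (K' + ∑ j, |A i j| * K j) * dist (p y.1) (p y.2) := by
        filter_upwards [hK', eventually_all.2 hK] with y hy1 hy2
        have h4 : σ (p y.1) i - σ (p y.2) i = (g i (F y.1) - g i (F y.2)) -
            ∑ j, A i j * (g j y.1 - g j y.2) := by
          rw [hσ, hσ]
          simp only [mul_sub, Finset.sum_sub_distrib]
          ring
        rw [h4, add_mul, Finset.sum_mul]
        refine (abs_sub _ _).trans (add_le_add hy1 ?_)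
        refine (Finset.abs_sum_le_sum_abs _ _).trans (Finset.sum_le_sum fun j _ => ?_)
        rw [abs_mul, mul_assoc]
        exact mul_le_mul_of_nonneg_left (hy2 j) (abs_nonneg _)
      obtain ⟨s, hs, hs'⟩ := Filter.mem_prod_same_iff.1 h3
      refine ⟨Real.toNNReal (K' + ∑ j, |A i j| * K j), p '' s, hp.image_mem_nhds hs, ?_⟩
      rw [lipschitzOnWith_iff_dist_le_mul]
      rintro _ ⟨y, hy, rfl⟩ _ ⟨z, hz, rfl⟩
      rw [Real.dist_eq]
      refine (hs' (mk_mem_prod hy hz)).trans ?_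
      gcongr
      exact Real.le_coe_toNNReal _
    obtain ⟨K, hK⟩ := hloc.locallyLipschitzOn.exists_lipschitzOnWith_of_compact
      (isCompact_univ (X := M))
    exact ⟨K, lipschitzOnWith_univ.1 hK⟩
  choose K hK using hcomp
  refine ⟨∑ i, K i, LipschitzWith.of_dist_le_mul fun m m' => ?_⟩
  rw [dist_pi_le_iff (by positivity)]
  intro i
  refine ((hK i).dist_le_mul m m').trans ?_
  gcongr
  exact Finset.single_le_sum (f := K) (fun _ _ => zero_le) (Finset.mem_univ i)

end Displacement

/-! ### The limit map -/

section Limit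

variable {b : ℕ} {A : Matrix (Fin b) (Fin b) ℝ} {X E : Type*} [TopologicalSpace X]
  {p : E → X} {F : E → E} {f : C(X, X)} {ι : E → Fin b → ℝ} {σ : C(X, Fin b → ℝ)}

theorem add_sum_range_eq_inv_pow_mulVec (hA : IsUnit A.det) (hF : ∀ x, p (F x) = f (p x))
    (hσ : ∀ x, σ (p x) = ι (F x) - A *ᵥ ι x) (x : E) (n : ℕ) :
    ι x + ∑ k ∈ Finset.range n, A⁻¹ ^ (k + 1) *ᵥ σ (f^[k] (p x)) = A⁻¹ ^ n *ᵥ ι (F^[n] x) := by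
  induction n with
  | zero => simp
  | succ n ih =>
    have h1 : f^[n] (p x) = p (F^[n] x) :=
      ((show Function.Semiconj p F f from hF).iterate_right n x).symm
    have h2 : A⁻¹ ^ (n + 1) * A = A⁻¹ ^ n := by
      rw [pow_succ, mul_assoc, Matrix.nonsing_inv_mul A hA, mul_one]
    rw [Finset.sum_range_succ, ← add_assoc, ih, h1, hσ, Matrix.mulVec_sub, Matrix.mulVec_mulVec,
      h2, Function.iterate_succ_apply', add_sub_cancel]

variable [CompactSpace X] {C q : ℝ}

theorem tendsto_inv_pow_mulVec (hA : IsUnit A.det) (hC : 0 ≤ C) (hq : 0 ≤ q) (hq1 : q < 1)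
    (hB : ∀ (n : ℕ) (v : Fin b → ℝ), ‖A⁻¹ ^ n *ᵥ v‖ ≤ C * q ^ n * ‖v‖)
    (hF : ∀ x, p (F x) = f (p x)) (hσ : ∀ x, σ (p x) = ι (F x) - A *ᵥ ι x) (x : E) :
    Tendsto (fun n : ℕ => A⁻¹ ^ n *ᵥ ι (F^[n] x)) atTop
      (𝓝 (ι x + correctionSeries A⁻¹ f σ (p x))) := by
  simp only [← add_sum_range_eq_inv_pow_mulVec hA hF hσ]
  exact (hasSum_correctionSeries f σ hC hq hq1 hB (p x)).tendsto_sum_nat.const_add _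

theorem apply_eq_mulVec_of_tendsto (hA : IsUnit A.det) {β : E → Fin b → ℝ}
    (hβ : ∀ x, Tendsto (fun n : ℕ => A⁻¹ ^ n *ᵥ ι (F^[n] x)) atTop (𝓝 (β x))) (x : E) :
    β (F x) = A *ᵥ β x := by
  have h1 : Tendsto (fun n : ℕ => A *ᵥ (A⁻¹ ^ (n + 1) *ᵥ ι (F^[n + 1] x))) atTop
      (𝓝 (A *ᵥ β x)) :=
    ((Continuous.matrix_mulVec continuous_const continuous_id).tendsto _).comp
      ((hβ x).comp (tendsto_add_atTop_nat 1))
  refine tendsto_nhds_unique (hβ (F x)) (h1.congr fun n => ?_)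
  rw [Matrix.mulVec_mulVec, pow_succ', ← mul_assoc, Matrix.mul_nonsing_inv A hA, one_mul,
    Function.iterate_succ_apply]

theorem apply_iterate_eq_mulVec {β : E → Fin b → ℝ} (hβ : ∀ x, β (F x) = A *ᵥ β x) (n : ℕ)
    (x : E) : β (F^[n] x) = A ^ n *ᵥ β x := by
  induction n with
  | zero => simp
  | succ n ih => rw [Function.iterate_succ_apply', hβ, ih, Matrix.mulVec_mulVec, pow_succ']

/-- A bounded error dies under `A⁻¹ ^ n`, while the same expression tends to `β x - y`. Conversely,
the error for `y = β x` is `ι - β` at the point `Fⁿ x`. -/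
theorem globallyShadows_iff (hA : IsUnit A.det) (hC : 0 ≤ C) (hq : 0 ≤ q) (hq1 : q < 1)
    (hB : ∀ (n : ℕ) (v : Fin b → ℝ), ‖A⁻¹ ^ n *ᵥ v‖ ≤ C * q ^ n * ‖v‖)
    {N : Seminorm ℝ (Fin b → ℝ)} (hN : ∀ v, N v = 0 → v = 0) {β : E → Fin b → ℝ}
    (hβ : ∀ x, Tendsto (fun n : ℕ => A⁻¹ ^ n *ᵥ ι (F^[n] x)) atTop (𝓝 (β x)))
    {D : ℝ} (hD : ∀ x, ‖β x - ι x‖ ≤ D) (x : E) (y : Fin b → ℝ) :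
    GloballyShadows N ι F A x y ↔ y = β x := by
  obtain ⟨c, c', hc, hc', hNc, hNc'⟩ := N.exists_norm_bounds hN
  constructor
  · rintro ⟨K, hK⟩
    have h1 : Tendsto (fun n : ℕ => A⁻¹ ^ n *ᵥ (ι (F^[n] x) - A ^ n *ᵥ y)) atTop (𝓝 0) := by
      refine squeeze_zero_norm (a := fun n => C * q ^ n * (c' * K)) (fun n => ?_) ?_
      · refine (hB n _).trans ?_
        gcongr
        exact (hNc' _).trans (by gcongr; exact hK n)
      · simpa using ((tendsto_pow_atTop_nhds_zero_of_lt_one hq hq1).const_mul C).mul_const (c' * K)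
    have h2 : Tendsto (fun n : ℕ => A⁻¹ ^ n *ᵥ (ι (F^[n] x) - A ^ n *ᵥ y)) atTop
        (𝓝 (β x - y)) := by
      refine ((hβ x).sub_const y).congr fun n => ?_
      rw [Matrix.mulVec_sub, Matrix.mulVec_mulVec, Matrix.inv_pow',
        Matrix.nonsing_inv_mul _ (by rw [Matrix.det_pow]; exact hA.pow n), Matrix.one_mulVec]
    exact (sub_eq_zero.1 (tendsto_nhds_unique h2 h1)).symm
  · rintro rfl
    refine ⟨c * D, fun n => (hNc _).trans ?_⟩
    rw [← apply_iterate_eq_mulVec (apply_eq_mulVec_of_tendsto hA hβ), norm_sub_rev]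
    gcongr
    exact hD _

end Limit

theorem shadowingMap_eq {b : ℕ} {A : Matrix (Fin b) (Fin b) ℝ} {E : Type v} {F : E → E}
    {ι : E → Fin b → ℝ} {N : Seminorm ℝ (Fin b → ℝ)} {x : E} {z : Fin b → ℝ}
    (h : ∀ y, GloballyShadows N ι F A x y ↔ y = z) : shadowingMap N ι F A x = z := by
  have h1 : ∃! y, GloballyShadows N ι F A x y := ⟨z, (h z).2 rfl, fun y hy => (h y).1 hy⟩
  rw [shadowingMap, dif_pos h1]
  exact (h _).1 h1.choose_spec.1

/-! ### Tori -/

section Torus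

variable {b : ℕ}

theorem continuous_torusProj : Continuous (torusProj (b := b)) :=
  continuous_pi fun i => (AddCircle.continuous_mk' 1).comp (continuous_apply i)

theorem torusProj_add_int (v : Fin b → ℝ) (n : Fin b → ℤ) :
    torusProj (v + fun i => (n i : ℝ)) = torusProj v := by
  ext i
  simp only [torusProj, Pi.add_apply, AddCircle.coe_add]
  rw [add_eq_left, AddCircle.coe_eq_zero_iff]
  exact ⟨n i, by simp⟩

theorem torusProj_mulVec (A : Matrix (Fin b) (Fin b) ℤ) (v : Fin b → ℝ) :
    torusProj (realMatrix A *ᵥ v) = toralEndomorphism A (torusProj v) := by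
  ext i
  have h : ∀ s : Finset (Fin b), ((∑ j ∈ s, (A i j : ℝ) * v j : ℝ) : UnitAddCircle) =
      ∑ j ∈ s, A i j • (v j : UnitAddCircle) := by
    intro s
    rw [← QuotientAddGroup.mk'_apply, map_sum]
    refine Finset.sum_congr rfl fun j _ => ?_
    rw [← zsmul_eq_mul, map_zsmul]
    rfl
  exact h Finset.univ

end Torus

/-! ### The covering -/

theorem Topology.IsQuotientMap.exists_continuousMap_comp_eq {X Y Z : Type*} [TopologicalSpace X]
    [TopologicalSpace Y] [TopologicalSpace Z] {p : C(X, Y)} (hp : IsQuotientMap p) (k : C(X, Z))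
    (hk : ∀ x y, p x = p y → k x = k y) : ∃ l : C(Y, Z), ∀ x, l (p x) = k x :=
  have h : Function.FactorsThrough k p := fun x y h => hk x y h
  ⟨hp.lift k h, fun x => DFunLike.congr_fun (hp.lift_comp k h) x⟩

/-- Fibres of a covering map may be empty a priori; path lifting from one point excludes this. -/
theorem IsCoveringMap.surjective {E M : Type*} [TopologicalSpace E] [TopologicalSpace M]
    [PathConnectedSpace M] [Nonempty E] {p : E → M} (hp : IsCoveringMap p) :
    Function.Surjective p := by
  intro m
  obtain ⟨x⟩ := ‹Nonempty E›
  let γ := PathConnectedSpace.somePath (p x) m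
  obtain ⟨Γ, hΓ, -⟩ := hp.exists_path_lifts γ x γ.source
  exact ⟨Γ 1, (congrFun hΓ 1).trans γ.target⟩

theorem LocalPrimitives.IsPrimitiveOf.continuous {d : ℕ} {M : Type u} [TopologicalSpace M]
    [ChartedSpace (EuclideanSpace ℝ (Fin d)) M] {P : LocalPrimitives M ℝ} {θ : OneForm d M}
    (hP : P.IsPrimitiveOf θ) {E : Type*} [TopologicalSpace E] {p : E → M} (hp : Continuous p)
    {g : E → ℝ} (hg : P.IsPrimitiveAlong p g) : Continuous g := by
  rw [continuous_iff_continuousAt]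
  intro x
  have h1 : ContinuousAt (P.h (p x)) (p x) :=
    (hP.contMDiffOn (p x)).continuousOn.continuousAt ((P.isOpen_U _).mem_nhds (P.mem_U _))
  have h2 : ContinuousAt (fun y => P.h (p x) (p y) - P.h (p x) (p x) + g x) x :=
    ((h1.comp hp.continuousAt).sub continuousAt_const).add continuousAt_const
  refine h2.congr ?_
  filter_upwards [hg x (p x) (P.mem_U _)] with y hy
  rw [← hy, sub_add_cancel]

/-! ### Hölder continuity -/

/-- The Lipschitz part `ι` is what limits the estimate to bounded scales: `t ≤ R ^ (1 - ν) t ^ ν`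
holds only for `t ≤ R`. -/
theorem exists_seminorm_sub_le_rpow {E : Type*} {b : ℕ} (N : Seminorm ℝ (Fin b → ℝ))
    (hN : ∀ v, N v = 0 → v = 0) {dE : E → E → ℝ≥0∞} {ι S : E → Fin b → ℝ} {K : ℝ≥0} {D ν : ℝ}
    (hν0 : 0 < ν) (hν1 : ν < 1)
    (hι : ∀ x y, edist (ι x) (ι y) ≤ K * dE x y)
    (hS : ∀ x y, dE x y ≠ ⊤ → ‖S x - S y‖ ≤ D * (dE x y).toReal ^ ν) (R : ℝ) :
    ∃ C : ℝ, ∀ x y, dE x y ≤ ENNReal.ofReal R →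
      N ((ι x + S x) - (ι y + S y)) ≤ C * (dE x y).toReal ^ ν := by
  obtain ⟨c, -, hc, -, hNc, -⟩ := N.exists_norm_bounds hN
  refine ⟨c * (K * (max R 0) ^ (1 - ν) + D), fun x y hxy => (hNc _).trans ?_⟩
  have hfin : dE x y ≠ ⊤ := ne_top_of_le_ne_top ENNReal.ofReal_ne_top hxy
  set t := (dE x y).toReal
  have ht : 0 ≤ t := ENNReal.toReal_nonneg
  have htR : t ≤ max R 0 := by
    have := ENNReal.toReal_mono ENNReal.ofReal_ne_top hxy
    rwa [ENNReal.toReal_ofReal'] at this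
  have h1 : ‖ι x - ι y‖ ≤ K * t := by
    have := ENNReal.toReal_mono (ENNReal.mul_ne_top ENNReal.coe_ne_top hfin) (hι x y)
    rwa [edist_dist, ENNReal.toReal_ofReal dist_nonneg, dist_eq_norm, ENNReal.toReal_mul,
      ENNReal.coe_toReal] at this
  have h2 : t ≤ (max R 0) ^ (1 - ν) * t ^ ν := by
    calc t = t ^ (1 - ν) * t ^ ν := by
          rw [← Real.rpow_add_of_nonneg ht (by linarith) hν0.le]; simp
      _ ≤ _ := by gcongr
  rw [mul_assoc]
  gcongr
  calc ‖ι x + S x - (ι y + S y)‖ = ‖(ι x - ι y) + (S x - S y)‖ := by congr 1; abel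
    _ ≤ K * t + D * t ^ ν := (norm_add_le _ _).trans (add_le_add h1 (hS x y hfin))
    _ ≤ K * ((max R 0) ^ (1 - ν) * t ^ ν) + D * t ^ ν := by gcongr
    _ = _ := by ring

theorem one_div_mul_rpow_lt_one {lam L ν : ℝ} (hlam : 1 < lam) (hL : 0 ≤ L) (hν0 : 0 < ν)
    (hν : ν < Real.log lam / Real.log L) : 1 / lam * L ^ ν < 1 := by
  have hlam0 : 0 < lam := by linarith
  -- For `L ≤ 1` the quotient of logarithms is at most `0`, division by zero included, so no `ν > 0`
  -- is admitted.
  have hlog : 0 < Real.log L := by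
    by_contra h
    have : Real.log lam / Real.log L ≤ 0 :=
      div_nonpos_of_nonneg_of_nonpos (Real.log_pos hlam).le (not_lt.1 h)
    linarith
  have hL0 : 0 < L := hL.lt_of_ne fun h => by simp [← h] at hlog
  rw [one_div, inv_mul_lt_iff₀ hlam0, mul_one, ← Real.log_lt_log_iff (by positivity) hlam0,
    Real.log_rpow hL0]
  exact (lt_div_iff₀ hlog).1 hν

end

theorem mainTheorem1 {d b : ℕ}
    -- a compact connected smooth Riemannian manifold `M`, with its Riemannian distance
    {M : Type u} [MetricSpace M] [CompactSpace M] [ConnectedSpace M]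
    [ChartedSpace (EuclideanSpace ℝ (Fin d)) M] [IsManifold (𝓡 d) ∞ M]
    [RiemannianBundle (fun x : M => TangentSpace (𝓡 d) x)]
    [IsContMDiffRiemannianBundle (𝓡 d) ∞ (EuclideanSpace ℝ (Fin d))
      (fun x : M => TangentSpace (𝓡 d) x)]
    [IsRiemannianManifold (𝓡 d) M]
    -- the universal Abelian cover
    {E : Type v} [TopologicalSpace E] (p : C(E, M)) (hp : IsUniversalAbelianCover p)
    -- a basis of `H₁(M; ℤ)` and a dual family of closed one-forms
    (Γ : Module.Basis (Fin b) ℤ (H1 M)) (θ : Fin b → OneForm d M)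
    (hθ : ∀ i, (θ i).IsSmoothClosed)
    (hdual : ∀ i j, (θ i).HasPeriod (Γ j) (if i = j then 1 else 0))
    (x₀ : E)
    -- the map `f`, a lift `F`, and the action on homology
    (f : C(M, M)) (F : C(E, E)) (hF : ∀ x, p (F x) = f (p x))
    (hexp : IsExpandingMatrix (homologyMatrix Γ f))
    -- a norm on `ℝ^b`
    (N : Seminorm ℝ (Fin b → ℝ)) (hN : ∀ v, N v = 0 → v = 0) :
    let A := realMatrix (homologyMatrix Γ f)
    let ι := abelJacobi p θ x₀
    let Φ := toralEndomorphism (homologyMatrix Γ f)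
    ∃ (σ : C(M, Fin b → ℝ)) (βt : C(E, Fin b → ℝ)) (β : C(M, Fin b → UnitAddCircle)),
      -- the displacement `σ`, the limit and the series
      (∀ x, σ (p x) = ι (F x) - A *ᵥ ι x) ∧
      (∀ x, Tendsto (fun n : ℕ => (A⁻¹) ^ n *ᵥ ι (F^[n] x)) atTop (𝓝 (βt x))) ∧
      (∀ x, HasSum (fun n : ℕ => (A⁻¹) ^ (n + 1) *ᵥ σ (f^[n] (p x))) (βt x - ι x)) ∧
      -- Hölder regularity on bounded scales, for the lifted Riemannian distance
      (∀ lam : ℝ, 1 < lam →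
        spectralRadius ℂ (complexMatrix (homologyMatrix Γ f))⁻¹ < ENNReal.ofReal (1 / lam) →
        ∀ L : ℝ≥0, LipschitzWith L f →
        ∀ ν : ℝ, 0 < ν → ν < min (Real.log lam / Real.log L) 1 →
        ∀ R : ℝ, ∃ C : ℝ, ∀ x y : E, coverEDist d p x y ≤ ENNReal.ofReal R →
          N (βt x - βt y) ≤ C * (coverEDist d p x y).toReal ^ ν) ∧
      -- equivariance
      (∀ (n : Fin b → ℤ) (δ : E ≃ₜ E), IsDeckTransformation p Γ n δ →
        ∀ x, βt (δ x) = βt x + fun i => (n i : ℝ)) ∧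
      (∀ x, βt (F x) = A *ᵥ βt x) ∧
      -- the semiconjugacy
      (∀ x, β (p x) = torusProj (βt x)) ∧
      (∀ x, β (f x) = Φ (β x)) ∧
      IsCompact (range β) ∧ MapsTo Φ (range β) (range β) ∧
      (Function.Surjective f → Φ '' range β = range β) ∧
      -- global shadowing
      (∀ x y, GloballyShadows N ι F A x y ↔ y = βt x) ∧
      (∀ x, βt x = shadowingMap N ι F A x) := by
  intro A ι Φ
  have hcov := hp.isCoveringMap
  have : PathConnectedSpace E := hp.pathConnectedSpace
  have : LocallyPathConnectedSpace M :=
    ChartedSpace.locallyPathConnectedSpace (EuclideanSpace ℝ (Fin d)) M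
  have : LocallyPathConnectedSpace E := hcov.isLocalHomeomorph.locallyPathConnectedSpace
  have : PathConnectedSpace M := pathConnectedSpace_iff_connectedSpace.2 inferInstance
  have hsurj : Function.Surjective p := hcov.surjective
  have hquot : IsQuotientMap p := hcov.isQuotientMap hsurj
  choose P hP using fun i => (hθ i).exists_localPrimitives
  choose g hg using fun i => (P i).exists_isPrimitiveAlong_of_range_le p
    fun y => (hp.range_map_eq y).le
  have hι : ∀ x i, ι x i = g i x - g i x₀ := fun x i => abelJacobi_eq_sub hcov hP hg x₀ x i
  have hιsub : ∀ x y i, ι y i - ι x i = g i y - g i x := fun x y i => by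
    rw [hι, hι, sub_sub_sub_cancel_right]
  have hιc : Continuous ι := continuous_pi fun i => by
    simp only [hι]
    exact ((hP i).continuous p.continuous (hg i)).sub continuous_const
  -- Over one fibre the ambiguity `A n` cancels in `σ`, and the ambiguity `n` of `βt` vanishes in
  -- the torus.
  have hint : ∀ x y, p y = p x → ∃ n : Fin b → ℤ, ι y = ι x + (fun i => (n i : ℝ)) ∧
      ι (F y) = ι (F x) + A *ᵥ fun i => (n i : ℝ) := by
    intro x y h
    obtain ⟨n, h1, h2⟩ := exists_int_of_map_eq hP hdual hg hF h
    refine ⟨n, funext fun i => ?_, funext fun i => ?_⟩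
    · rw [Pi.add_apply, ← h1, ← hιsub, add_sub_cancel]
    · rw [Pi.add_apply, ← h2, ← hιsub, add_sub_cancel]
  have hσc : Continuous fun x => ι (F x) - A *ᵥ ι x :=
    (hιc.comp F.continuous).sub (Continuous.matrix_mulVec continuous_const hιc)
  obtain ⟨σ, hσ⟩ := hquot.exists_continuousMap_comp_eq ⟨_, hσc⟩ fun x y h => by
    obtain ⟨n, h1, h2⟩ := hint y x h
    simp only [ContinuousMap.coe_mk]
    rw [h1, h2, Matrix.mulVec_add, add_sub_add_right_eq_sub]
  simp only [ContinuousMap.coe_mk] at hσ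
  have hA : IsUnit A.det := hexp.isUnit_det_realMatrix
  obtain ⟨q, hq0, hqr, hq1⟩ : ∃ q : ℝ, 0 < q ∧
      spectralRadius ℂ (complexMatrix (homologyMatrix Γ f))⁻¹ < ENNReal.ofReal q ∧ q < 1 := by
    obtain ⟨r, hr1, hr2⟩ := ENNReal.lt_iff_exists_nnreal_btwn.1 hexp.spectralRadius_inv_lt_one
    refine ⟨r, ?_, by rwa [ENNReal.ofReal_coe_nnreal], by exact_mod_cast hr2⟩
    exact_mod_cast (zero_le.trans_lt hr1 : (0 : ℝ≥0∞) < r)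
  obtain ⟨C, hC, hB⟩ := hexp.exists_norm_inv_pow_mulVec_le hq0 hqr
  let S := correctionSeries A⁻¹ f σ
  have hSc : Continuous S := continuous_correctionSeries f σ hC hq0.le hq1 hB
  let βt : C(E, Fin b → ℝ) := ⟨fun x => ι x + S (p x), hιc.add (hSc.comp p.continuous)⟩
  have hβt : ∀ x, βt x = ι x + S (p x) := fun _ => rfl
  have hlim : ∀ x, Tendsto (fun n : ℕ => A⁻¹ ^ n *ᵥ ι (F^[n] x)) atTop (𝓝 (βt x)) :=
    tendsto_inv_pow_mulVec hA hC hq0.le hq1 hB hF hσ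
  have hβF : ∀ x, βt (F x) = A *ᵥ βt x := apply_eq_mulVec_of_tendsto hA hlim
  have hτc : Continuous fun x => torusProj (βt x) := continuous_torusProj.comp βt.continuous
  obtain ⟨β, hβ⟩ := hquot.exists_continuousMap_comp_eq ⟨_, hτc⟩ fun x y h => by
    obtain ⟨n, h1, -⟩ := hint y x h
    simp only [ContinuousMap.coe_mk]
    rw [hβt, hβt, h, h1, add_right_comm, torusProj_add_int]
  simp only [ContinuousMap.coe_mk] at hβ
  have hβf : ∀ x, β (f x) = Φ (β x) := fun x => by
    obtain ⟨x, rfl⟩ := hsurj x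
    rw [← hF, hβ, hβ, hβF]
    exact torusProj_mulVec _ _
  obtain ⟨D, hD⟩ := exists_norm_correctionSeries_le f σ hC hq0.le hq1 hB
  have hshadow : ∀ x y, GloballyShadows N ι F A x y ↔ y = βt x :=
    globallyShadows_iff hA hC hq0.le hq1 hB hN hlim (D := D) fun x => by
      rw [hβt, add_sub_cancel_left]
      exact hD _
  refine ⟨σ, βt, β, hσ, hlim, fun x => ?_, fun lam hlam hlamr L hL ν hν0 hν R => ?_,
    fun n δ ⟨hδ, hn⟩ x => ?_, hβF, hβ, hβf, isCompact_range β.continuous, ?_, fun hf => ?_,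
    hshadow, fun x => (shadowingMap_eq (hshadow x)).symm⟩
  · rw [hβt, add_sub_cancel_left]
    exact hasSum_correctionSeries f σ hC hq0.le hq1 hB (p x)
  · obtain ⟨hνL, hν1⟩ := lt_min_iff.1 hν
    have hlam0 : 0 < 1 / lam := by positivity
    have hlam1 : 1 / lam < 1 := by rwa [div_lt_one (by linarith)]
    -- The contraction rate is now `1 / lam` instead of `q`, to match the bound on `ν`.
    obtain ⟨C', hC', hB'⟩ := hexp.exists_norm_inv_pow_mulVec_le hlam0 hlamr
    -- The constant `a` accounts for the normalisation `ι = g - g x₀`.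
    obtain ⟨K, hK⟩ := exists_lipschitzWith_displacement hP hcov.isOpenMap hsurj hF hL hg
      (A := A) (a := fun i => ∑ j, A i j * g j x₀ - g i x₀) (σ := σ) fun x i => by
        rw [hσ, Pi.sub_apply, hι, Matrix.mulVec, dotProduct]
        simp only [hι, mul_sub, Finset.sum_sub_distrib]
        ring
    obtain ⟨D', hD', hS⟩ := exists_norm_correctionSeries_sub_le hC' hlam0.le hlam1 hB' hK hL hν0
      hν1.le (one_div_mul_rpow_lt_one hlam L.2 hν0 hνL)
    choose k hk using fun i => (hP i).exists_edist_le_coverEDist (hg i)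
    refine exists_seminorm_sub_le_rpow N hN (dE := coverEDist d p) (ι := ι) (S := S ∘ p)
      (K := ∑ i, k i) (D := D') hν0 hν1 (fun x y => ?_) (fun x y hxy => ?_) R
    · refine edist_pi_le_iff.2 fun i => ?_
      have h1 : edist (ι x i) (ι y i) = edist (g i x) (g i y) := by
        rw [edist_dist, edist_dist, Real.dist_eq, Real.dist_eq, hιsub]
      rw [h1]
      refine (hk i x y).trans ?_
      gcongr
      exact Finset.single_le_sum (f := k) (fun _ _ => zero_le) (Finset.mem_univ i)
    · refine (hS (p x) (p y)).trans ?_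
      gcongr
      rw [dist_edist]
      exact ENNReal.toReal_mono hxy (edist_le_coverEDist p x y)
  · have h1 : ι (δ x) = ι x + fun i => (n i : ℝ) := funext fun i => by
      rw [Pi.add_apply, ← sub_eq_of_loopClass_eq hP hdual hg (hδ x)
        (PathConnectedSpace.somePath x (δ x)) (hn x _) i, ← hιsub, add_sub_cancel]
    rw [hβt, hβt, hδ, h1, add_right_comm]
  · rintro _ ⟨x, rfl⟩
    exact ⟨f x, hβf x⟩
  · refine Subset.antisymm ?_ ?_
    · rintro _ ⟨_, ⟨x, rfl⟩, rfl⟩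
      exact ⟨f x, hβf x⟩
    · rintro _ ⟨x, rfl⟩
      obtain ⟨y, rfl⟩ := hf x
      exact ⟨β y, ⟨y, rfl⟩, (hβf y).symm⟩
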